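/- Let $\Bbbk$ be an algebraically closed field of characteristic zero and let $b\ge 2$ be an integer. Let $\mathbb X\subset\mathbb P^2_{\Bbbk}$ be the standard $\Bbbk$-configuration of type $(1,b,2b+1)$, i.e. the set of the $3b+2$ points $$[1:0:2],\qquad [1:j:1]\ (0\le j\le b-1),\qquad [1:j:0]\ (0\le j\le 2b).$$ Let $I_{\mathbb X}\subset \Bbbk[x_0,x_1,x_2]$ be the homogeneous ideal of $\mathbb X$, let $I_{\mathbb X}^{(t)}$ be its $t$-th symbolic power, and let $\alpha(J)$ denote the least degree of a nonzero form in a nonzero homogeneous ideal $J$. Then the Waldschmidt constant of $I_{\mathbb X}$ is $$\widehat\alpha(I_{\mathbb X})=\lim_{t\to\infty}\frac{\alpha(I_{\mathbb X}^{(t)})}{t}=\frac{6b^2-2b-3}{2b^2-1}.$$ -/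

import Mathlib

open Filter Topology
open scoped LinearAlgebra.Projectivization

/-- The homogeneous ideal `I_X` of a set `X` of points of the projective plane: the ideal of
`𝕜[x₀, x₁, x₂]` generated by all forms vanishing at every point of `X`. -/
noncomputable def vanishingIdealP2 {𝕜 : Type*} [Field 𝕜] (X : Set (ℙ 𝕜 (Fin 3 → 𝕜))) :
    Ideal (MvPolynomial (Fin 3) 𝕜) :=
  Ideal.span {f | (∃ n : ℕ, f.IsHomogeneous n) ∧ ∀ P ∈ X, MvPolynomial.eval P.rep f = 0}

/-- The `t`-th symbolic power `I^(t) = ⋂_{p ∈ Ass(R/I)} (I^t R_p ∩ R)` of an ideal `I`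
of a Noetherian ring `R`. -/
noncomputable def symbolicPower {R : Type*} [CommRing R] (I : Ideal R) (t : ℕ) : Ideal R :=
  ⨅ p : associatedPrimes R (R ⧸ I),
    ((I ^ t).map (algebraMap R (Localization.AtPrime p.1))).comap
      (algebraMap R (Localization.AtPrime p.1))

/-- The initial degree `α(I)`: the least degree of a nonzero form in the homogeneous ideal `I`. -/
noncomputable def initialDegree {σ 𝕜 : Type*} [Field 𝕜] (I : Ideal (MvPolynomial σ 𝕜)) : ℕ :=
  sInf {n : ℕ | ∃ f ∈ I, f ≠ 0 ∧ f.IsHomogeneous n}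

/-- `w` is the Waldschmidt constant of `I`: the limit `lim_{t → ∞} α(I^(t)) / t` exists and
equals `w`. -/
def IsWaldschmidtConstant {σ 𝕜 : Type*} [Field 𝕜] (I : Ideal (MvPolynomial σ 𝕜)) (w : ℝ) : Prop :=
  Tendsto (fun t : ℕ => (initialDegree (symbolicPower I t) : ℝ) / (t : ℝ)) atTop (𝓝 w)

/-- The point `[1 : a : c]` of the projective plane. -/
def affinePointP2 {𝕜 : Type*} [Field 𝕜] (a c : 𝕜) : ℙ 𝕜 (Fin 3 → 𝕜) :=
  Projectivization.mk 𝕜 ![1, a, c] (fun h => one_ne_zero (congrFun h 0))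

/-- The standard `𝕜`-configuration of type `(d₁, …, d_s)` (meaningful for `1 ≤ d₁ < ⋯ < d_s`):
the points `[1 : j : s - i]` with `1 ≤ i ≤ s` and `0 ≤ j ≤ d_i - 1`.
As the index `i : Fin s` starts at `0`, `s - i` becomes `s - (i + 1)`. -/
def standardConfiguration (𝕜 : Type*) [Field 𝕜] {s : ℕ} (d : Fin s → ℕ) :
    Set (ℙ 𝕜 (Fin 3 → 𝕜)) :=
  {P | ∃ (i : Fin s) (j : ℕ), j < d i ∧ P = affinePointP2 (j : 𝕜) ((s : 𝕜) - (((i : ℕ) : 𝕜) + 1))}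

/-! Write `P` for the apex `[1:0:2]`. The line of slope `j` through `P`, for `j < b`, also contains
`[1:j:1]` and `[1:2j:0]`. The remaining `b + 1` points of the long row (odd indices and `2b`) lie on
none of these lines. For each such point, indexed by `k`, there is a rational curve of degree `b`
with multiplicity at least `b - 1` at `P`, through the middle row and through all these remaining
points except the `k`-th.

Upper bound: take the `b` lines with exponent `b`, all `b + 1` curves once, and the two rows with
exponents that top up the multiplicities. This gives a form of degree `6b² - 2b - 3` in the `(2b² -
1)`-th power of every point ideal (`exists_form_mem_pointIdeal_pow`); its powers serve for all `t`.

Lower bound: use slope `x` and height `y` as seen from `P`. A form of degree `n` with multiplicity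
`t` at every point becomes a bivariate polynomial of total degree at most `n` and `y`-degree at most
`n - t`. If none of the lines and curves is a component, Bezout on each of them, with weight `1` for
a line and `2b - 2` for a curve, yields a linear inequality, expressed as nonnegativity of `defect`.
The defect is additive over products and nonnegative on the lines and curves themselves, so
components can be split off and the inequality always holds (`defect_nonneg`). Inserting the degrees
and multiplicities gives `b(6b² - 2b - 3)t ≤ b(2b² - 1)n`. -/

open MvPolynomial in
theorem aeval_const_mul_of_isHomogeneous {σ R B : Type*} [CommSemiring R] [CommSemiring B]
    [Algebra R B] {f : MvPolynomial σ R} {n : ℕ} (hf : f.IsHomogeneous n) (r : B) (w : σ → B) :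
    aeval (fun i => r * w i) f = r ^ n * aeval w f := by
  simp only [aeval_def, eval₂_eq, Finset.mul_sum]
  refine Finset.sum_congr rfl fun d hd => ?_
  have h : ∑ i ∈ d.support, d i = n := by
    have := hf (mem_support_iff.1 hd)
    simpa [Finsupp.weight_apply, Finsupp.sum] using this
  simp only [mul_pow, Finset.prod_mul_distrib, Finset.prod_pow_eq_pow_sum, h]
  ring

/-! ### Homogeneous primes of points -/

section PointIdeal

variable {σ 𝕜 : Type*} [Field 𝕜]

/-- The homogeneous prime ideal of the point with homogeneous coordinates `v`. -/
noncomputable def pointIdeal (v : σ → 𝕜) : Ideal (MvPolynomial σ 𝕜) :=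
  RingHom.ker (MvPolynomial.aeval (fun i => Polynomial.X * Polynomial.C (v i)) :
    MvPolynomial σ 𝕜 →ₐ[𝕜] Polynomial 𝕜)

instance pointIdeal_isPrime (v : σ → 𝕜) : (pointIdeal v).IsPrime := RingHom.ker_isPrime _

theorem aeval_C_eq_C_eval (v : σ → 𝕜) (f : MvPolynomial σ 𝕜) :
    MvPolynomial.aeval (fun i => Polynomial.C (v i)) f = Polynomial.C (MvPolynomial.eval v f) := by
  have h : (MvPolynomial.aeval (fun i => Polynomial.C (v i)) :
      MvPolynomial σ 𝕜 →ₐ[𝕜] Polynomial 𝕜) =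
      (Polynomial.CAlgHom (R := 𝕜) (A := 𝕜)).comp (MvPolynomial.aeval v) := by
    ext i : 1; simp
  rw [h]; simp [MvPolynomial.aeval_eq_eval]

theorem mem_pointIdeal_of_isHomogeneous {v : σ → 𝕜} {f : MvPolynomial σ 𝕜} {n : ℕ}
    (hf : f.IsHomogeneous n) : f ∈ pointIdeal v ↔ MvPolynomial.eval v f = 0 := by
  rw [pointIdeal, RingHom.mem_ker, aeval_const_mul_of_isHomogeneous hf, aeval_C_eq_C_eval]
  simp

theorem mem_pointIdeal_iff {v : σ → 𝕜} {f : MvPolynomial σ 𝕜} :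
    f ∈ pointIdeal v ↔ ∀ n, MvPolynomial.eval v (f.homogeneousComponent n) = 0 := by
  have key : (MvPolynomial.aeval (fun i => Polynomial.X * Polynomial.C (v i)) f : Polynomial 𝕜) =
      ∑ n ∈ Finset.range (f.totalDegree + 1),
        Polynomial.X ^ n * Polynomial.C (MvPolynomial.eval v (f.homogeneousComponent n)) := by
    conv_lhs => rw [← f.sum_homogeneousComponent, map_sum]
    refine Finset.sum_congr rfl fun n _ => ?_
    rw [aeval_const_mul_of_isHomogeneous (f.homogeneousComponent_isHomogeneous n), aeval_C_eq_C_eval]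
  rw [pointIdeal, RingHom.mem_ker, key]
  constructor
  · intro h n
    by_cases hn : n < f.totalDegree + 1
    · have := congrArg (fun p => p.coeff n) h
      simpa [Polynomial.finsetSum_coeff, Polynomial.coeff_X_pow_mul', Polynomial.coeff_C,
        Finset.sum_ite, Nat.sub_eq_zero_iff_le, Finset.filter_filter, ← le_antisymm_iff, hn,
        Finset.filter_eq, Polynomial.coeff_X_pow] using this
    · rw [MvPolynomial.homogeneousComponent_eq_zero _ _ (by omega), map_zero]
  · intro h
    exact Finset.sum_eq_zero fun n _ => by rw [h, map_zero, mul_zero]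

theorem pointIdeal_smul {a : 𝕜} (ha : a ≠ 0) (v : σ → 𝕜) :
    pointIdeal (a • v) = pointIdeal v := by
  ext f
  rw [mem_pointIdeal_iff, mem_pointIdeal_iff]
  refine forall_congr' fun n => ?_
  have := aeval_const_mul_of_isHomogeneous (f.homogeneousComponent_isHomogeneous n) a v
  rw [MvPolynomial.aeval_eq_eval, MvPolynomial.aeval_eq_eval] at this
  change MvPolynomial.eval (fun i => a * v i) _ = 0 ↔ _
  rw [this, mul_eq_zero, or_iff_right (pow_ne_zero _ ha)]

/-- Modulo `p` the substitution is `x_i ↦ v_i l`, which factors through the parametrization whose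
kernel is the point ideal. -/
theorem dvd_aeval_of_mem_pointIdeal {B : Type*} [CommRing B] [Algebra 𝕜 B] (v : σ → 𝕜)
    {f : MvPolynomial σ 𝕜} (l p : B) (w : σ → B) (hf : f ∈ pointIdeal v) :
    p ∣ MvPolynomial.aeval (fun i => algebraMap 𝕜 B (v i) * l + p * w i) f := by
  rw [← Ideal.mem_span_singleton, ← Ideal.Quotient.eq_zero_iff_mem]
  have hp : Ideal.Quotient.mk (Ideal.span {p}) p = 0 :=
    Ideal.Quotient.eq_zero_iff_mem.2 (Ideal.mem_span_singleton_self p)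
  have h : (Ideal.Quotient.mkₐ 𝕜 (Ideal.span {p})).comp
      (MvPolynomial.aeval (fun i => algebraMap 𝕜 B (v i) * l + p * w i)) =
      (Polynomial.aeval (Ideal.Quotient.mkₐ 𝕜 (Ideal.span {p}) l)).comp
      (MvPolynomial.aeval (fun i => Polynomial.X * Polynomial.C (v i))) := by
    refine MvPolynomial.algHom_ext fun i => ?_
    simp only [AlgHom.comp_apply, MvPolynomial.aeval_X, map_add, map_mul, Polynomial.aeval_X,
      Polynomial.aeval_C, Ideal.Quotient.mkₐ_eq_mk, hp, zero_mul, add_zero]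
    rw [mul_comm]
    rfl
  have h2 := DFunLike.congr_fun h f
  rw [pointIdeal, RingHom.mem_ker] at hf
  rwa [AlgHom.comp_apply, AlgHom.comp_apply, hf, map_zero] at h2

end PointIdeal

/-! ### Symbolic powers of the ideal of finitely many points -/

section SymbolicPower

variable {𝕜 : Type*} [Field 𝕜] {X : Set (ℙ 𝕜 (Fin 3 → 𝕜))}

theorem mem_vanishingIdealP2_iff {f : MvPolynomial (Fin 3) 𝕜} :
    f ∈ vanishingIdealP2 X ↔ ∀ P ∈ X, f ∈ pointIdeal P.rep := by
  constructor
  · intro hf P hP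
    refine (Ideal.span_le.2 ?_ : vanishingIdealP2 X ≤ pointIdeal P.rep) hf
    rintro g ⟨⟨n, hn⟩, hg⟩
    exact (mem_pointIdeal_of_isHomogeneous hn).2 (hg P hP)
  · intro h
    rw [← f.sum_homogeneousComponent]
    exact Ideal.sum_mem _ fun n _ => Ideal.subset_span
      ⟨⟨n, f.homogeneousComponent_isHomogeneous n⟩, fun P hP => mem_pointIdeal_iff.1 (h P hP) n⟩

theorem exists_mem_pointIdeal_notMem {P Q : ℙ 𝕜 (Fin 3 → 𝕜)} (h : Q ≠ P) :
    ∃ f, f ∈ pointIdeal Q.rep ∧ f ∉ pointIdeal P.rep := by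
  obtain ⟨i, hi⟩ := Function.ne_iff.1 Q.rep_nonzero
  have hom : ∀ j, (MvPolynomial.C (Q.rep i) * MvPolynomial.X j -
      MvPolynomial.C (Q.rep j) * MvPolynomial.X i).IsHomogeneous 1 := fun j =>
    ((MvPolynomial.isHomogeneous_C_mul_X _ _).sub (MvPolynomial.isHomogeneous_C_mul_X _ _))
  by_contra! hc
  have key : ∀ j, Q.rep i * P.rep j = Q.rep j * P.rep i := fun j => by
    have := hc _ ((mem_pointIdeal_of_isHomogeneous (hom j)).2 (by simp [mul_comm]))
    rw [mem_pointIdeal_of_isHomogeneous (hom j)] at this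
    simpa [sub_eq_zero] using this
  simp only [Pi.zero_apply, ne_eq] at hi
  apply h
  rw [← Q.mk_rep, ← P.mk_rep, eq_comm, Projectivization.mk_eq_mk_iff']
  refine ⟨P.rep i / Q.rep i, funext fun j => ?_⟩
  simp only [Pi.smul_apply, smul_eq_mul]
  field_simp
  linear_combination -key j

/-- Multiply linear forms, one through each other point and missing `P`. Such an `e` becomes a unit
in the localization at `P` and multiplies the ideal of `P` into the ideal of `X`. -/
theorem exists_separator (hX : X.Finite) (P : ℙ 𝕜 (Fin 3 → 𝕜)) :
    ∃ e, e ∉ pointIdeal P.rep ∧ ∀ Q ∈ X, Q ≠ P → e ∈ pointIdeal Q.rep := by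
  classical
  choose! F hF hF' using fun Q (h : Q ≠ P) => exists_mem_pointIdeal_notMem h
  refine ⟨∏ Q ∈ hX.toFinset.erase P, F Q, fun h => ?_, fun Q hQ hQP => ?_⟩
  · obtain ⟨Q, hQ, h⟩ := Ideal.IsPrime.prod_mem_iff.1 h
    exact hF' Q (Finset.ne_of_mem_erase hQ) h
  · exact Ideal.mem_of_dvd _ (Finset.dvd_prod_of_mem F (by simp [hQ, hQP])) (hF Q hQP)

theorem mul_mem_vanishingIdealP2 {P : ℙ 𝕜 (Fin 3 → 𝕜)} {e f : MvPolynomial (Fin 3) 𝕜}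
    (he : ∀ Q ∈ X, Q ≠ P → e ∈ pointIdeal Q.rep) (hf : f ∈ pointIdeal P.rep) :
    e * f ∈ vanishingIdealP2 X := by
  rw [mem_vanishingIdealP2_iff]
  intro Q hQ
  by_cases h : Q = P
  · exact h ▸ Ideal.mul_mem_left _ _ hf
  · exact Ideal.mul_mem_right _ _ (he Q hQ h)

theorem mem_colon_bot_mk {R : Type*} [CommRing R] {I : Ideal R} {e r : R} :
    r ∈ (⊥ : Submodule R (R ⧸ I)).colon {Ideal.Quotient.mk I e} ↔ r * e ∈ I := by
  rw [Submodule.mem_colon_singleton, Submodule.mem_bot, ← Ideal.Quotient.eq_zero_iff_mem, map_mul]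
  rfl

theorem pointIdeal_mem_associatedPrimes (hX : X.Finite) {P : ℙ 𝕜 (Fin 3 → 𝕜)} (hP : P ∈ X) :
    pointIdeal P.rep ∈ associatedPrimes (MvPolynomial (Fin 3) 𝕜)
      (MvPolynomial (Fin 3) 𝕜 ⧸ vanishingIdealP2 X) := by
  rw [AssociatedPrimes.mem_iff, isAssociatedPrime_iff]
  obtain ⟨e, he, he'⟩ := exists_separator hX P
  refine ⟨inferInstance, Ideal.Quotient.mk _ e, ?_⟩
  ext r
  rw [mem_colon_bot_mk]
  constructor
  · intro hr
    rw [mul_comm]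
    exact mul_mem_vanishingIdealP2 he' hr
  · intro h
    exact ((pointIdeal_isPrime P.rep).mem_or_mem
      (mem_vanishingIdealP2_iff.1 h P hP)).resolve_right he

/-- The annihilator of the class of `e` contains the intersection of the ideals of those points
where `e` does not vanish. Being prime, it contains one of them, and primality of that one gives the
reverse inclusion. -/
theorem eq_pointIdeal_of_mem_associatedPrimes (hX : X.Finite)
    {p : Ideal (MvPolynomial (Fin 3) 𝕜)}
    (hp : p ∈ associatedPrimes (MvPolynomial (Fin 3) 𝕜)
      (MvPolynomial (Fin 3) 𝕜 ⧸ vanishingIdealP2 X)) :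
    ∃ P ∈ X, p = pointIdeal P.rep := by
  rw [AssociatedPrimes.mem_iff, isAssociatedPrime_iff] at hp
  obtain ⟨hp, x, hx⟩ := hp
  obtain ⟨e, rfl⟩ := Ideal.Quotient.mk_surjective x
  have hmem : ∀ r, r ∈ p ↔ r * e ∈ vanishingIdealP2 X := fun r => by rw [hx, mem_colon_bot_mk]
  classical
  have hle : (hX.toFinset.filter fun P => e ∉ pointIdeal P.rep).inf
      (fun P => pointIdeal P.rep) ≤ p := by
    intro r hr
    rw [hmem, mem_vanishingIdealP2_iff]
    intro P hP
    by_cases h : e ∈ pointIdeal P.rep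
    · exact Ideal.mul_mem_left _ _ h
    · rw [Submodule.mem_finsetInf] at hr
      exact Ideal.mul_mem_right _ _ (hr P (by simp [hP, h]))
  obtain ⟨P, hP, hPp⟩ := (hp.inf_le').1 hle
  simp only [Finset.mem_filter, Set.Finite.mem_toFinset] at hP
  refine ⟨P, hP.1, le_antisymm (fun r hr => ?_) hPp⟩
  rw [hmem, mem_vanishingIdealP2_iff] at hr
  exact ((pointIdeal_isPrime P.rep).mem_or_mem (hr P hP.1)).resolve_right hP.2

theorem mem_symbolicPower_of_forall (hX : X.Finite) {t : ℕ} {f : MvPolynomial (Fin 3) 𝕜}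
    (hf : ∀ P ∈ X, f ∈ pointIdeal P.rep ^ t) : f ∈ symbolicPower (vanishingIdealP2 X) t := by
  rw [symbolicPower, Submodule.mem_iInf]
  rintro ⟨p, hp⟩
  obtain ⟨P, hP, rfl⟩ := eq_pointIdeal_of_mem_associatedPrimes hX hp
  obtain ⟨e, he, he'⟩ := exists_separator hX P
  rw [Ideal.mem_comap, IsLocalization.algebraMap_mem_map_algebraMap_iff
    (pointIdeal P.rep).primeCompl]
  refine ⟨e ^ t, Submonoid.pow_mem _ he t, ?_⟩
  have hle : Ideal.span {e} * pointIdeal P.rep ≤ vanishingIdealP2 X := by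
    rw [Ideal.span_singleton_mul_le_iff]
    exact fun z hz => mul_mem_vanishingIdealP2 he' hz
  refine Ideal.pow_right_mono hle t ?_
  rw [mul_pow, Ideal.span_singleton_pow]
  exact Ideal.mul_mem_mul (Ideal.mem_span_singleton_self _) (hf P hP)

theorem exists_mul_mem_of_mem_symbolicPower (hX : X.Finite) {t : ℕ} {f : MvPolynomial (Fin 3) 𝕜}
    (hf : f ∈ symbolicPower (vanishingIdealP2 X) t) {P : ℙ 𝕜 (Fin 3 → 𝕜)} (hP : P ∈ X) :
    ∃ e ∉ pointIdeal P.rep, e * f ∈ pointIdeal P.rep ^ t := by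
  rw [symbolicPower, Submodule.mem_iInf] at hf
  have h := hf ⟨_, pointIdeal_mem_associatedPrimes hX hP⟩
  rw [Ideal.mem_comap, IsLocalization.algebraMap_mem_map_algebraMap_iff
    (pointIdeal P.rep).primeCompl] at h
  obtain ⟨e, he, h⟩ := h
  exact ⟨e, he, Ideal.pow_right_mono (fun g hg => mem_vanishingIdealP2_iff.1 hg P hP) t h⟩

/-- An element of the symbolic power vanishes to order `t` along each point: a substitution which
moves away from the line over the point by multiples of `p` gives a multiple of `p ^ t`. -/
theorem pow_dvd_aeval_of_mem_symbolicPower (hX : X.Finite) {t : ℕ} {f : MvPolynomial (Fin 3) 𝕜}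
    (hf : f ∈ symbolicPower (vanishingIdealP2 X) t) {v : Fin 3 → 𝕜} (hv : v ≠ 0)
    (hP : Projectivization.mk 𝕜 v hv ∈ X) {B : Type*} [CommRing B] [Algebra 𝕜 B]
    (l p : B) (w : Fin 3 → B) :
    p ^ t ∣ MvPolynomial.aeval (fun i => algebraMap 𝕜 B (v i) * l + p * w i) f := by
  obtain ⟨e, he, hef⟩ := exists_mul_mem_of_mem_symbolicPower hX hf hP
  obtain ⟨a, ha⟩ := Projectivization.exists_smul_eq_mk_rep 𝕜 v hv
  rw [← ha, Units.smul_def, pointIdeal_smul a.ne_zero] at he hef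
  -- The generic substitution: `l`, `p` and the `w i` are independent variables, with `p` the outer
  -- one. The given substitution is a specialization of it.
  let φ : MvPolynomial (Fin 3) 𝕜 →ₐ[𝕜] Polynomial (MvPolynomial (Option (Fin 3)) 𝕜) :=
    MvPolynomial.aeval fun i =>
    algebraMap 𝕜 _ (v i) * Polynomial.C (MvPolynomial.X none) +
      Polynomial.X * Polynomial.C (MvPolynomial.X (some i))
  have h1 : Polynomial.X ^ t ∣ φ (e * f) := by
    have : pointIdeal v ≤
        (Ideal.span {(Polynomial.X : Polynomial (MvPolynomial (Option (Fin 3)) 𝕜))}).comap φ := by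
      intro g hg
      rw [Ideal.mem_comap, Ideal.mem_span_singleton]
      exact dvd_aeval_of_mem_pointIdeal v _ _ _ hg
    have := (Ideal.pow_right_mono this t).trans (Ideal.le_comap_pow _ t) hef
    rwa [Ideal.mem_comap, Ideal.span_singleton_pow, Ideal.mem_span_singleton] at this
  -- Setting the outer variable to `0` and all others to a single variable recovers the
  -- parametrization of the point, which does not kill `e`.
  have h2 : ¬ Polynomial.X ∣ φ e := by
    intro hd
    rw [Polynomial.X_dvd_iff, Polynomial.coeff_zero_eq_eval_zero] at hd
    apply he
    rw [pointIdeal, RingHom.mem_ker]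
    let χ : Polynomial (MvPolynomial (Option (Fin 3)) 𝕜) →ₐ[𝕜] Polynomial 𝕜 :=
      (MvPolynomial.aeval (fun _ => Polynomial.X)).comp
        ((Polynomial.aeval (0 : MvPolynomial (Option (Fin 3)) 𝕜)).restrictScalars 𝕜)
    have hχ : χ.comp φ = MvPolynomial.aeval (fun i => Polynomial.X * Polynomial.C (v i)) := by
      refine MvPolynomial.algHom_ext fun i => ?_
      simp [χ, φ]
    rw [← hχ]
    simp [χ, hd]
  rw [map_mul] at h1
  -- Primality of the outer variable removes the factor `e`; this is why the generic ring, a domain,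
  -- is used before specializing to an arbitrary `B`.
  have h3 := (Polynomial.prime_X.pow_dvd_of_dvd_mul_left t h2 h1)
  let ψ : Polynomial (MvPolynomial (Option (Fin 3)) 𝕜) →ₐ[𝕜] B := Polynomial.eval₂AlgHom
    (MvPolynomial.aeval fun o : Option (Fin 3) => o.elim l w) p
    (fun _ => Commute.all _ _)
  have hψ : ψ.comp φ = MvPolynomial.aeval (fun i => algebraMap 𝕜 B (v i) * l + p * w i) := by
    refine MvPolynomial.algHom_ext fun i => ?_
    simp [ψ, φ, mul_comm p]
  rw [← hψ]
  have := map_dvd ψ h3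
  simpa [ψ] using this

end SymbolicPower

/-! ### Degrees, orders of vanishing and Bezout bounds for bivariate polynomials -/

section Bivariate

open Polynomial

variable {𝕜 : Type*} [Field 𝕜] {A : Type*} [CommRing A] [Algebra 𝕜 A]

/-- Substitution of `x` for the inner and `y` for the outer variable. -/
noncomputable def biSubst (x y : A) : 𝕜[X][X] →ₐ[𝕜] A :=
  eval₂AlgHom (aeval x) y (fun _ => Commute.all _ _)

theorem biSubst_apply (x y : A) (G : 𝕜[X][X]) :
    biSubst x y G = eval₂ (aeval x : 𝕜[X] →ₐ[𝕜] A).toRingHom y G := rfl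

@[simp] theorem biSubst_C (x y : A) (p : 𝕜[X]) : biSubst x y (C p) = aeval x p := by
  simp [biSubst_apply]

@[simp] theorem biSubst_X (x y : A) : biSubst x y (X : 𝕜[X][X]) = y := by
  simp [biSubst_apply]

theorem biAlgHom_ext {φ ψ : 𝕜[X][X] →ₐ[𝕜] A} (h1 : φ (C X) = ψ (C X)) (h2 : φ X = ψ X) :
    φ = ψ := by
  refine AlgHom.coe_ringHom_injective (Polynomial.ringHom_ext' ?_ h2)
  refine Polynomial.ringHom_ext' (RingHom.ext fun a => ?_) h1
  exact (φ.commutes a).trans (ψ.commutes a).symm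

theorem algHom_comp_biSubst {B : Type*} [CommRing B] [Algebra 𝕜 B] (φ : A →ₐ[𝕜] B) (x y : A) :
    φ.comp (biSubst x y) = biSubst (φ x) (φ y) :=
  biAlgHom_ext (by simp) (by simp)

theorem map_biSubst {B : Type*} [CommRing B] [Algebra 𝕜 B] (φ : A →ₐ[𝕜] B) (x y : A)
    (G : 𝕜[X][X]) : φ (biSubst x y G) = biSubst (φ x) (φ y) G :=
  DFunLike.congr_fun (algHom_comp_biSubst φ x y) G

theorem biSubst_C_X_X : biSubst (C X : 𝕜[X][X]) X = AlgHom.id 𝕜 𝕜[X][X] :=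
  biAlgHom_ext (by simp) (by simp)

/-- The degree of a bivariate polynomial in both variables together. -/
noncomputable def biTotalDegree (G : 𝕜[X][X]) : ℕ :=
  (biSubst (X : 𝕜[X][X]) (C X * X) G).natDegree

/-- The monomial `x^m y^n` goes to outer degree `m + n` with inner degree `n`: the outer degree
reads off the total degree, and no information is lost. -/
theorem coeff_coeff_biSubst_shear (G : 𝕜[X][X]) (d i : ℕ) :
    ((biSubst (X : 𝕜[X][X]) (C X * X) G).coeff d).coeff i =
      if i ≤ d then (G.coeff i).coeff (d - i) else 0 := by
  induction G using Polynomial.induction_on' with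
  | add p q hp hq =>
    simp only [map_add, coeff_add, hp, hq]
    split_ifs <;> simp
  | monomial n p =>
    induction p using Polynomial.induction_on' with
    | add p q hp hq =>
      simp only [map_add, coeff_add, hp, hq]
      split_ifs <;> simp
    | monomial m a =>
      have : biSubst (X : 𝕜[X][X]) (C X * X) (monomial n (monomial m a)) =
          monomial (n + m) (monomial n a) := by
        rw [← C_mul_X_pow_eq_monomial, map_mul, map_pow, biSubst_C, biSubst_X, aeval_monomial,
          mul_pow, ← C_mul_X_pow_eq_monomial, ← C_mul_X_pow_eq_monomial (n := n)]
        simp only [C_mul, C_pow]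
        rw [IsScalarTower.algebraMap_apply 𝕜 𝕜[X] 𝕜[X][X]]
        simp only [algebraMap_eq]
        ring
      rw [this]
      simp only [coeff_monomial]
      by_cases h1 : n + m = d
      · subst h1
        by_cases h2 : n = i
        · subst h2; simp
        · simp [coeff_monomial, h2]
      · by_cases h2 : n = i
        · subst h2
          simp only [h1, if_false, coeff_zero, if_true, coeff_monomial]
          split_ifs <;> first | rfl | omega
        · simp [h1, h2]

theorem biSubst_shear_injective :
    Function.Injective (biSubst (X : 𝕜[X][X]) (C X * X) : 𝕜[X][X] →ₐ[𝕜] 𝕜[X][X]) := by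
  rw [injective_iff_map_eq_zero]
  intro G hG
  ext i e
  have := coeff_coeff_biSubst_shear G (e + i) i
  simpa [hG] using this.symm

theorem biTotalDegree_mul {F G : 𝕜[X][X]} (hF : F ≠ 0) (hG : G ≠ 0) :
    biTotalDegree (F * G) = biTotalDegree F + biTotalDegree G := by
  rw [biTotalDegree, map_mul, natDegree_mul]
  · rfl
  · rwa [Ne, map_eq_zero_iff _ biSubst_shear_injective]
  · rwa [Ne, map_eq_zero_iff _ biSubst_shear_injective]

theorem natDegree_coeff_add_le {G : 𝕜[X][X]} {i : ℕ} (h : G.coeff i ≠ 0) :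
    (G.coeff i).natDegree + i ≤ biTotalDegree G := by
  apply le_natDegree_of_ne_zero
  intro h0
  have := coeff_coeff_biSubst_shear G ((G.coeff i).natDegree + i) i
  rw [h0] at this
  simp at this
  exact h (leadingCoeff_eq_zero.1 this.symm)

theorem natDegree_le_biTotalDegree (G : 𝕜[X][X]) : G.natDegree ≤ biTotalDegree G := by
  by_cases h : G = 0
  · simp [h]
  · exact (Nat.le_add_left _ _).trans
      (natDegree_coeff_add_le (i := G.natDegree) (by simpa using h))

/-- The Taylor expansion at `(a, b)`, graded by the powers of the outer variable. -/
noncomputable def localExpansion (a b : 𝕜) : 𝕜[X][X] →ₐ[𝕜] (MvPolynomial (Fin 2) 𝕜)[X] :=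
  biSubst (algebraMap 𝕜 _ a + X * C (MvPolynomial.X 0))
    (algebraMap 𝕜 _ b + X * C (MvPolynomial.X 1))

theorem biSubst_eq_localExpansion (a b : 𝕜) (p s t : A) (G : 𝕜[X][X]) :
    biSubst (algebraMap 𝕜 A a + p * s) (algebraMap 𝕜 A b + p * t) G =
      eval₂AlgHom (MvPolynomial.aeval ![s, t]) p (fun _ => Commute.all _ _)
        (localExpansion a b G) := by
  rw [localExpansion, map_biSubst]
  congr 2
  · rw [map_add, map_mul, AlgHom.commutes]
    simp
  · rw [map_add, map_mul, AlgHom.commutes]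
    simp

theorem localExpansion_injective (a b : 𝕜) : Function.Injective (localExpansion a b) := by
  rw [injective_iff_map_eq_zero]
  intro G hG
  have h := biSubst_eq_localExpansion (A := 𝕜[X][X]) a b 1 (C X - algebraMap 𝕜 _ a)
    (X - algebraMap 𝕜 _ b) G
  rw [hG, map_zero, one_mul, one_mul, add_sub_cancel, add_sub_cancel] at h
  rwa [biSubst_C_X_X] at h

/-- The order of vanishing at the point `(a, b)`. -/
noncomputable def orderAt (a b : 𝕜) (G : 𝕜[X][X]) : ℕ := (localExpansion a b G).natTrailingDegree

theorem orderAt_mul (a b : 𝕜) {F G : 𝕜[X][X]} (hF : F ≠ 0) (hG : G ≠ 0) :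
    orderAt a b (F * G) = orderAt a b F + orderAt a b G := by
  rw [orderAt, map_mul, natTrailingDegree_mul]
  · rfl
  · rwa [Ne, map_eq_zero_iff _ (localExpansion_injective a b)]
  · rwa [Ne, map_eq_zero_iff _ (localExpansion_injective a b)]

theorem le_orderAt {a b : 𝕜} {G : 𝕜[X][X]} (hG : G ≠ 0) {m : ℕ} (h : X ^ m ∣ localExpansion a b G) :
    m ≤ orderAt a b G := by
  apply le_natTrailingDegree
  · simpa [map_eq_zero_iff _ (localExpansion_injective a b)]
  · exact X_pow_dvd_iff.1 h

theorem pow_orderAt_dvd_biSubst (a b : 𝕜) (p s t : A) (G : 𝕜[X][X]) :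
    p ^ orderAt a b G ∣ biSubst (algebraMap 𝕜 A a + p * s) (algebraMap 𝕜 A b + p * t) G := by
  rw [biSubst_eq_localExpansion]
  have h : X ^ orderAt a b G ∣ localExpansion a b G :=
    X_pow_dvd_iff.2 fun d hd => coeff_eq_zero_of_lt_natTrailingDegree hd
  simpa using map_dvd (eval₂AlgHom (MvPolynomial.aeval ![s, t]) p (fun _ => Commute.all _ _) :
    (MvPolynomial (Fin 2) 𝕜)[X] →ₐ[𝕜] A) h

theorem orderAt_eq_zero {a b : 𝕜} {G : 𝕜[X][X]} (h : biSubst a b G ≠ 0) : orderAt a b G = 0 := by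
  by_contra h0
  have := pow_orderAt_dvd_biSubst (A := 𝕜) a b 0 0 0 G
  rw [zero_pow h0, zero_dvd_iff] at this
  simp at this
  exact h this

theorem pow_orderAt_dvd_map_eval (a b : 𝕜) (G : 𝕜[X][X]) :
    (X - C b) ^ orderAt a b G ∣ G.map (evalRingHom a) := by
  have h := pow_orderAt_dvd_biSubst (A := 𝕜[X]) a b (X - C b) 0 1 G
  have h2 : biSubst (algebraMap 𝕜 𝕜[X] a) X =
      (mapAlgHom (aeval a) : 𝕜[X][X] →ₐ[𝕜] 𝕜[X]) := biAlgHom_ext (by simp) (by simp)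
  rw [mul_zero, add_zero, mul_one, algebraMap_eq, add_sub_cancel, ← algebraMap_eq, h2] at h
  exact h

theorem orderAt_le_natDegree {a : 𝕜} {G : 𝕜[X][X]} (hG : G.map (evalRingHom a) ≠ 0) (b : 𝕜) :
    orderAt a b G ≤ G.natDegree := by
  have := natDegree_le_of_dvd (pow_orderAt_dvd_map_eval a b G) hG
  rw [natDegree_pow, natDegree_X_sub_C, mul_one] at this
  exact this.trans natDegree_map_le

/-- Bezout on the line `x = a` through the apex: only the `y`-degree counts. -/
theorem orderAt_add_orderAt_le {a : 𝕜} {G : 𝕜[X][X]} (hG : G.map (evalRingHom a) ≠ 0) {b c : 𝕜}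
    (h : b ≠ c) : orderAt a b G + orderAt a c G ≤ G.natDegree := by
  have hd := IsCoprime.mul_dvd ((pairwise_coprime_X_sub_C Function.injective_id h).pow
    (m := orderAt a b G) (n := orderAt a c G))
    (pow_orderAt_dvd_map_eval a b G) (pow_orderAt_dvd_map_eval a c G)
  have := natDegree_le_of_dvd hd hG
  rw [natDegree_mul (pow_ne_zero _ (X_sub_C_ne_zero _)) (pow_ne_zero _ (X_sub_C_ne_zero _)),
    natDegree_pow, natDegree_pow, id, id, natDegree_X_sub_C, natDegree_X_sub_C, mul_one,
    mul_one] at this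
  exact this.trans natDegree_map_le

theorem C_X_sub_C_dvd {a : 𝕜} {G : 𝕜[X][X]} (hG : G.map (evalRingHom a) = 0) :
    C (X - C a) ∣ G := by
  rw [C_dvd_iff_dvd_coeff]
  intro i
  rw [dvd_iff_isRoot, IsRoot, ← coe_evalRingHom, ← coeff_map, hG, coeff_zero]

/-- The evaluation is `f^N G(x, -g/f)` with `N` the `y`-degree, that is, `G` restricted to the
rational graph `y = -g/f` with denominators cleared. Modulo the power of `x - a`, `f` is a unit and
`-g/f` differs from `b` by a multiple of `x - a`, so `G` vanishes there to the required order. -/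
theorem pow_orderAt_dvd_eval_scaleRoots {a b : 𝕜} {f g : 𝕜[X]} (hf : f.eval a ≠ 0)
    (hg : b * f.eval a + g.eval a = 0) (G : 𝕜[X][X]) :
    (X - C a) ^ orderAt a b G ∣ eval (-g) (G.scaleRoots f) := by
  set m := orderAt a b G with hm
  have hcop : IsCoprime f ((X - C a) ^ m) := by
    refine IsCoprime.pow_right (IsCoprime.symm ?_)
    rw [(irreducible_X_sub_C a).coprime_iff_not_dvd, dvd_iff_isRoot]
    exact hf
  obtain ⟨q, r, hqr⟩ := hcop
  obtain ⟨k, hk⟩ : X - C a ∣ C b * f + g := by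
    rw [dvd_iff_isRoot]
    simpa using hg
  let mk := Ideal.Quotient.mkₐ 𝕜 (Ideal.span {(X - C a) ^ m})
  have h0 : mk ((X - C a) ^ m) = 0 :=
    Ideal.Quotient.eq_zero_iff_mem.2 (Ideal.mem_span_singleton_self _)
  have hfq : mk f * mk q = 1 := by
    rw [mul_comm, ← map_one mk, ← hqr, map_add, map_mul, map_mul mk r, h0, mul_zero, add_zero]
  have hd := pow_orderAt_dvd_biSubst a b (mk (X - C a)) 1 (-(mk k * mk q)) G
  rw [← hm, ← map_pow, h0, zero_dvd_iff, mul_one] at hd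
  have hC : ∀ c, mk (C c) = algebraMap 𝕜 _ c := fun c => mk.commutes c
  have hx : algebraMap 𝕜 _ a + mk (X - C a) = mk X := by
    rw [map_sub, hC]; ring
  have hy : algebraMap 𝕜 _ b + mk (X - C a) * -(mk k * mk q) = mk (-g) * mk q := by
    have hk' := congrArg mk hk
    rw [map_add, map_mul, map_mul, hC] at hk'
    rw [map_neg]
    linear_combination (mk q) * hk' + (- algebraMap 𝕜 _ b) * hfq
  rw [hx, hy, biSubst_apply] at hd
  have hmk : (aeval (mk X) : 𝕜[X] →ₐ[𝕜] _).toRingHom = mk.toRingHom := by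
    have : (aeval (mk X) : 𝕜[X] →ₐ[𝕜] _) = mk := Polynomial.algHom_ext (by simp)
    rw [this]
  rw [hmk] at hd
  have key := scaleRoots_eval₂_mul (p := G) mk.toRingHom (mk (-g) * mk q) f
  rw [hd, mul_zero] at key
  have h2 : mk.toRingHom f * (mk (-g) * mk q) = mk.toRingHom (-g) := by
    change mk f * (mk (-g) * mk q) = mk (-g)
    linear_combination mk (-g) * hfq
  rw [h2, eval₂_at_apply] at key
  exact Ideal.mem_span_singleton.1 (Ideal.Quotient.eq_zero_iff_mem.1 key)

theorem natDegree_eval_scaleRoots_le {f g : 𝕜[X]} {e : ℕ} (hf : f.natDegree ≤ e)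
    (hg : g.natDegree ≤ e + 1) (G : 𝕜[X][X]) :
    (eval (-g) (G.scaleRoots f)).natDegree ≤ biTotalDegree G + e * G.natDegree := by
  rw [eval_eq_sum_range, natDegree_scaleRoots]
  refine natDegree_sum_le_of_forall_le _ _ fun i hi => ?_
  rw [coeff_scaleRoots]
  have hi : i ≤ G.natDegree := Nat.lt_succ_iff.1 (Finset.mem_range.1 hi)
  by_cases h : G.coeff i = 0
  · simp [h]
  have h1 := natDegree_coeff_add_le h
  have h2 := natDegree_mul_le (p := G.coeff i * f ^ (G.natDegree - i)) (q := (-g) ^ i)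
  have h3 := natDegree_mul_le (p := G.coeff i) (q := f ^ (G.natDegree - i))
  have h4 : (f ^ (G.natDegree - i)).natDegree ≤ (G.natDegree - i) * e :=
    natDegree_pow_le.trans (Nat.mul_le_mul_left _ hf)
  have h5 : ((-g) ^ i).natDegree ≤ i * (e + 1) :=
    natDegree_pow_le.trans (Nat.mul_le_mul_left _ (by rwa [natDegree_neg]))
  obtain ⟨c, hc⟩ := Nat.exists_eq_add_of_le hi
  rw [hc] at h2 h3 h4 ⊢
  rw [Nat.add_sub_cancel_left] at h2 h3 h4 ⊢
  nlinarith

/-- Bezout on the graph `y = -g/f`: distinct slopes give coprime factors, and their product divides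
a polynomial in one variable of bounded degree. -/
theorem sum_orderAt_le {ι : Type*} {S : Finset ι} {a b : ι → 𝕜} (ha : Set.InjOn a S)
    {f g : 𝕜[X]} {e : ℕ} (hf : f.natDegree ≤ e) (hg : g.natDegree ≤ e + 1)
    (hfa : ∀ i ∈ S, f.eval (a i) ≠ 0) (hga : ∀ i ∈ S, b i * f.eval (a i) + g.eval (a i) = 0)
    {G : 𝕜[X][X]} (hG : eval (-g) (G.scaleRoots f) ≠ 0) :
    ∑ i ∈ S, orderAt (a i) (b i) G ≤ biTotalDegree G + e * G.natDegree := by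
  have hd : ∏ i ∈ S, (X - C (a i)) ^ orderAt (a i) (b i) G ∣ eval (-g) (G.scaleRoots f) := by
    refine Finset.prod_dvd_of_coprime (fun i hi j hj hij => ?_) fun i hi =>
      pow_orderAt_dvd_eval_scaleRoots (hfa i hi) (hga i hi) G
    exact IsCoprime.pow (pairwise_coprime_X_sub_C Function.injective_id (ha.ne hi hj hij))
  have := (natDegree_le_of_dvd hd hG).trans (natDegree_eval_scaleRoots_le hf hg G)
  rw [natDegree_prod _ _ fun i _ => pow_ne_zero _ (X_sub_C_ne_zero _)] at this
  simpa only [natDegree_pow, natDegree_X_sub_C, mul_one] using this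

/-- Over the fraction field, `-g/f` is a root of `G`. Coprimality makes the linear polynomial
primitive, so Gauss's lemma descends the divisibility. -/
theorem C_mul_X_add_C_dvd {f g : 𝕜[X]} (hf : f ≠ 0) (hfg : IsCoprime f g) {G : 𝕜[X][X]}
    (hG : eval (-g) (G.scaleRoots f) = 0) : C f * X + C g ∣ G := by
  have hprim : (C f * X + C g).IsPrimitive := by
    intro r hr
    rw [C_dvd_iff_dvd_coeff] at hr
    have h0 := hr 0
    have h1 := hr 1
    simp at h0 h1
    exact hfg.isUnit_of_dvd' h1 h0
  let K := FractionRing 𝕜[X]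
  rw [hprim.dvd_iff_fraction_map_dvd_fraction_map K]
  have hfK : algebraMap 𝕜[X] K f ≠ 0 := by
    simpa using hf
  have hroot : eval₂ (algebraMap 𝕜[X] K) (-algebraMap 𝕜[X] K g / algebraMap 𝕜[X] K f) G = 0 := by
    have := scaleRoots_eval₂_mul (p := G) (algebraMap 𝕜[X] K)
      (-algebraMap 𝕜[X] K g / algebraMap 𝕜[X] K f) f
    rw [mul_div_cancel₀ _ hfK, ← map_neg, eval₂_at_apply, hG, map_zero] at this
    simpa [hfK] using this.symm
  have hd : X - C (-algebraMap 𝕜[X] K g / algebraMap 𝕜[X] K f) ∣ G.map (algebraMap 𝕜[X] K) := by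
    rw [dvd_iff_isRoot, IsRoot, eval_map]
    exact hroot
  refine dvd_trans ?_ hd
  refine ⟨C (algebraMap 𝕜[X] K f)⁻¹, ?_⟩
  have hC : C (algebraMap 𝕜[X] K f) * C (algebraMap 𝕜[X] K f)⁻¹ = 1 := by
    rw [← C_mul, mul_inv_cancel₀ hfK, C_1]
  simp only [Polynomial.map_add, Polynomial.map_mul, map_C, map_X, div_eq_mul_inv, C_mul, C_neg]
  linear_combination (-X) * hC

end Bivariate

/-! ### The lines, the rational curves and the defect inequality -/

section Configuration

open Polynomial

variable {𝕜 : Type*} [Field 𝕜]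

/-- The indices of the points of the long row which lie on no line through three points: the odd
numbers below `2 * b`, and `2 * b` itself. -/
def oddIndex (b i : ℕ) : ℕ := min (2 * i + 1) (2 * b)

theorem oddIndex_ne {b i j : ℕ} (hi : i ≤ b) (hj : j < b) : oddIndex b i ≠ 2 * j := by
  unfold oddIndex; omega

theorem oddIndex_injOn (b : ℕ) : Set.InjOn (oddIndex b) (Finset.range (b + 1)) := by
  intro i hi j hj h
  simp only [Finset.coe_range, Set.mem_Iio] at hi hj
  unfold oddIndex at h; omega

theorem oddIndex_div_two_ne [CharZero 𝕜] {b i j : ℕ} (hi : i ≤ b) (hj : j < b) :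
    (oddIndex b i : 𝕜) / 2 ≠ j := by
  rw [Ne, div_eq_iff two_ne_zero, mul_comm]
  exact_mod_cast oddIndex_ne hi hj

theorem oddIndex_div_two_injOn [CharZero 𝕜] (b : ℕ) :
    Set.InjOn (fun i => (oddIndex b i : 𝕜) / 2) (Finset.range (b + 1)) := by
  intro i hi j hj h
  refine oddIndex_injOn b hi hj ?_
  simpa [div_left_inj' (two_ne_zero (α := 𝕜))] using h

/-- The polynomial with roots `0, …, b - 1`. -/
noncomputable def rowPoly (𝕜 : Type*) [Field 𝕜] (b : ℕ) : 𝕜[X] :=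
  ∏ j ∈ Finset.range b, (X - C (j : 𝕜))

/-- The polynomial whose roots are the halves of the numbers `oddIndex b i` with `i ≠ k`. -/
noncomputable def oddPoly (𝕜 : Type*) [Field 𝕜] (b k : ℕ) : 𝕜[X] :=
  ∏ i ∈ (Finset.range (b + 1)).erase k, (X - C ((oddIndex b i : 𝕜) / 2))

theorem rowPoly_monic (b : ℕ) : (rowPoly 𝕜 b).Monic :=
  monic_prod_of_monic _ _ fun _ _ => monic_X_sub_C _

theorem oddPoly_monic (b k : ℕ) : (oddPoly 𝕜 b k).Monic :=
  monic_prod_of_monic _ _ fun _ _ => monic_X_sub_C _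

theorem natDegree_rowPoly (b : ℕ) : (rowPoly 𝕜 b).natDegree = b := by
  rw [rowPoly, natDegree_prod_of_monic _ _ fun _ _ => monic_X_sub_C _]
  simp only [natDegree_X_sub_C, Finset.sum_const, Finset.card_range, smul_eq_mul, mul_one]

theorem natDegree_oddPoly {b k : ℕ} (hk : k ≤ b) : (oddPoly 𝕜 b k).natDegree = b := by
  rw [oddPoly, natDegree_prod_of_monic _ _ fun _ _ => monic_X_sub_C _]
  simp [Finset.card_erase_of_mem, Nat.lt_succ_of_le hk]

/-- The leading terms cancel. This keeps the total degree of the curve at `b`, although its equation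
has a term multiplied by `y`. -/
theorem natDegree_rowPoly_sub_oddPoly_le {b k : ℕ} (hk : k ≤ b) :
    (rowPoly 𝕜 b - oddPoly 𝕜 b k).natDegree ≤ b - 1 := by
  have h := degree_sub_lt_left (p := rowPoly 𝕜 b) (q := oddPoly 𝕜 b k)
    (by rw [degree_eq_natDegree (rowPoly_monic b).ne_zero,
          degree_eq_natDegree (oddPoly_monic b k).ne_zero, natDegree_rowPoly,
          natDegree_oddPoly hk])
    (rowPoly_monic b).ne_zero (by rw [rowPoly_monic b, oddPoly_monic b k])
  rw [degree_eq_natDegree (rowPoly_monic b).ne_zero, natDegree_rowPoly] at h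
  have := natDegree_le_of_degree_le h.le
  by_cases h0 : rowPoly 𝕜 b - oddPoly 𝕜 b k = 0
  · simp [h0]
  · rw [← natDegree_lt_iff_degree_lt h0] at h
    omega

theorem rowPoly_eval_natCast {b j : ℕ} (hj : j < b) : (rowPoly 𝕜 b).eval (j : 𝕜) = 0 := by
  rw [rowPoly, eval_prod]
  exact Finset.prod_eq_zero (Finset.mem_range.2 hj) (by simp)

theorem oddPoly_eval_oddIndex {b k i : ℕ} (hi : i ∈ (Finset.range (b + 1)).erase k) :
    (oddPoly 𝕜 b k).eval ((oddIndex b i : 𝕜) / 2) = 0 := by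
  rw [oddPoly, eval_prod]
  exact Finset.prod_eq_zero hi (by simp)

/-- The equation of the rational curve of degree `b` through all points of the middle row and all
but one of the special points of the long row, as a polynomial in the slope and the height. -/
noncomputable def curvePoly (𝕜 : Type*) [Field 𝕜] (b k : ℕ) : 𝕜[X][X] :=
  C (rowPoly 𝕜 b - oddPoly 𝕜 b k) * X + C (oddPoly 𝕜 b k)

/-- The excess in the inequality between the degrees of a plane curve and its multiplicities at the
points of the configuration. -/
noncomputable def defect (b : ℕ) (G : 𝕜[X][X]) : ℤ :=
  2 * b ^ 2 * biTotalDegree G + (2 * b ^ 3 - 2 * b ^ 2 - b) * G.natDegree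
    - (2 * b ^ 2 - 1) * ∑ j ∈ Finset.range b, (orderAt (j : 𝕜) 1 G : ℤ)
    - ∑ j ∈ Finset.range b, (orderAt (j : 𝕜) 0 G : ℤ)
    - (2 * b ^ 2 - 2 * b) * ∑ i ∈ Finset.range (b + 1), (orderAt ((oddIndex b i : 𝕜) / 2) 0 G : ℤ)

theorem defect_mul (b : ℕ) {F G : 𝕜[X][X]} (hF : F ≠ 0) (hG : G ≠ 0) :
    defect b (F * G) = defect b F + defect b G := by
  simp only [defect, biTotalDegree_mul hF hG, natDegree_mul hF hG, orderAt_mul _ _ hF hG,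
    Nat.cast_add, Finset.sum_add_distrib]
  ring

theorem orderAt_C_X_sub_C [DecidableEq 𝕜] (a b c : 𝕜) :
    orderAt a b (C (X - C c)) = if a = c then 1 else 0 := by
  split_ifs with h
  · subst h
    have : localExpansion a b (C (X - C a)) = C (MvPolynomial.X 0) * X := by
      rw [localExpansion, biSubst_C, map_sub, aeval_X, aeval_C]
      ring
    rw [orderAt, this, C_mul_X_eq_monomial, natTrailingDegree_monomial (MvPolynomial.X_ne_zero _)]
  · apply orderAt_eq_zero
    simpa [sub_eq_zero] using h

theorem one_le_biTotalDegree_C_X_sub_C (c : 𝕜) : 1 ≤ biTotalDegree (C (X - C c)) := by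
  have h := natDegree_coeff_add_le (G := C (X - C c)) (i := 0)
    (by rw [coeff_C_zero]; exact X_sub_C_ne_zero _)
  rwa [coeff_C_zero, natDegree_X_sub_C] at h

variable [CharZero 𝕜]

theorem rowPoly_eval_oddIndex_ne_zero {b i : ℕ} (hi : i ≤ b) :
    (rowPoly 𝕜 b).eval ((oddIndex b i : 𝕜) / 2) ≠ 0 := by
  rw [rowPoly, eval_prod, Finset.prod_ne_zero_iff]
  intro j hj
  simpa [sub_eq_zero] using oddIndex_div_two_ne hi (Finset.mem_range.1 hj)

theorem oddPoly_eval_natCast_ne_zero {b k j : ℕ} (hj : j < b) :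
    (oddPoly 𝕜 b k).eval (j : 𝕜) ≠ 0 := by
  rw [oddPoly, eval_prod, Finset.prod_ne_zero_iff]
  intro i hi
  have := oddIndex_div_two_ne (𝕜 := 𝕜)
    (Nat.lt_succ_iff.1 (Finset.mem_range.1 (Finset.mem_of_mem_erase hi))) hj
  simpa [sub_eq_zero] using this.symm

theorem oddPoly_eval_self_ne_zero {b k : ℕ} (hk : k ≤ b) :
    (oddPoly 𝕜 b k).eval ((oddIndex b k : 𝕜) / 2) ≠ 0 := by
  rw [oddPoly, eval_prod, Finset.prod_ne_zero_iff]
  intro i hi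
  have := (oddIndex_div_two_injOn (𝕜 := 𝕜) b).ne (Finset.mem_of_mem_erase hi)
    (Finset.mem_coe.2 (Finset.mem_range.2 (Nat.lt_succ_of_le hk))) (Finset.ne_of_mem_erase hi)
  simpa [sub_eq_zero] using this.symm

theorem isCoprime_rowPoly_oddPoly {b k : ℕ} : IsCoprime (rowPoly 𝕜 b) (oddPoly 𝕜 b k) := by
  refine IsCoprime.prod_left fun j hj => ?_
  rw [(irreducible_X_sub_C _).coprime_iff_not_dvd, dvd_iff_isRoot]
  exact oddPoly_eval_natCast_ne_zero (Finset.mem_range.1 hj)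

theorem rowPoly_sub_oddPoly_ne_zero {b k : ℕ} (hb : 0 < b) :
    rowPoly 𝕜 b - oddPoly 𝕜 b k ≠ 0 := by
  intro h
  have := congrArg (eval ((0 : ℕ) : 𝕜)) h
  rw [eval_sub, rowPoly_eval_natCast hb, zero_sub, eval_zero, neg_eq_zero] at this
  exact oddPoly_eval_natCast_ne_zero hb this

/-- The line meets one point of the middle row and one even point of the long row: `2b² - (2b² - 1)
- 1 = 0`. -/
theorem defect_line_nonneg {b j : ℕ} (hj : j < b) : 0 ≤ defect b (C (X - C (j : 𝕜))) := by
  classical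
  have h0 : ∑ i ∈ Finset.range (b + 1),
      (orderAt ((oddIndex b i : 𝕜) / 2) 0 (C (X - C (j : 𝕜))) : ℤ) = 0 := by
    refine Finset.sum_eq_zero fun i hi => ?_
    rw [orderAt_C_X_sub_C, if_neg (oddIndex_div_two_ne
      (Nat.lt_succ_iff.1 (Finset.mem_range.1 hi)) hj), Nat.cast_zero]
  have h1 : ∀ c : 𝕜, ∑ i ∈ Finset.range b, (orderAt (i : 𝕜) c (C (X - C (j : 𝕜))) : ℤ) = 1 := by
    intro c
    simp only [orderAt_C_X_sub_C, Nat.cast_inj]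
    simp [hj]
  rw [defect, h0, h1, h1, natDegree_C]
  have : (1 : ℤ) ≤ biTotalDegree (C (X - C (j : 𝕜))) := by
    exact_mod_cast one_le_biTotalDegree_C_X_sub_C (j : 𝕜)
  have := mul_le_mul_of_nonneg_left this (by positivity : (0 : ℤ) ≤ 2 * b ^ 2)
  push_cast
  linarith

/-- The curve has total degree at least `b`, `y`-degree `1`, and at most simple passage through `b`
middle and `b` special points; with these values the terms balance to `0`. -/
theorem defect_curvePoly_nonneg {b k : ℕ} (hb : 2 ≤ b) (hk : k ≤ b) :
    0 ≤ defect b (curvePoly 𝕜 b k) := by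
  have hb0 : 0 < b := by omega
  have hdeg : (curvePoly 𝕜 b k).natDegree = 1 :=
    natDegree_linear (rowPoly_sub_oddPoly_ne_zero hb0)
  have htd : b ≤ biTotalDegree (curvePoly 𝕜 b k) := by
    have h0 : (curvePoly 𝕜 b k).coeff 0 = oddPoly 𝕜 b k := by simp [curvePoly]
    have := natDegree_coeff_add_le (G := curvePoly 𝕜 b k) (i := 0)
      (by rw [h0]; exact (oddPoly_monic b k).ne_zero)
    rwa [h0, natDegree_oddPoly hk, add_zero] at this
  have hval : ∀ a c : 𝕜, biSubst a c (curvePoly 𝕜 b k) =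
      ((rowPoly 𝕜 b).eval a - (oddPoly 𝕜 b k).eval a) * c + (oddPoly 𝕜 b k).eval a := by
    intro a c
    simp [curvePoly, aeval_def, eval₂_eq_eval_map]
  have hle : ∀ a c : 𝕜, (rowPoly 𝕜 b - oddPoly 𝕜 b k).eval a ≠ 0 →
      orderAt a c (curvePoly 𝕜 b k) ≤ 1 := by
    intro a c ha
    rw [← hdeg]
    refine orderAt_le_natDegree (fun h => ha ?_) c
    have := congrArg (fun p => p.coeff 1) h
    simpa [curvePoly] using this
  have h1 : ∑ j ∈ Finset.range b, (orderAt (j : 𝕜) 1 (curvePoly 𝕜 b k) : ℤ) ≤ b := by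
    have : ∀ j ∈ Finset.range b, (orderAt (j : 𝕜) 1 (curvePoly 𝕜 b k) : ℤ) ≤ 1 := by
      intro j hj
      have hj := Finset.mem_range.1 hj
      exact_mod_cast hle _ _ (by
        rw [eval_sub, rowPoly_eval_natCast hj, zero_sub, neg_ne_zero]
        exact oddPoly_eval_natCast_ne_zero hj)
    simpa using Finset.sum_le_card_nsmul _ _ _ this
  have h2 : ∑ j ∈ Finset.range b, (orderAt (j : 𝕜) 0 (curvePoly 𝕜 b k) : ℤ) = 0 := by
    refine Finset.sum_eq_zero fun j hj => ?_
    rw [orderAt_eq_zero, Nat.cast_zero]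
    rw [hval, mul_zero, zero_add]
    exact oddPoly_eval_natCast_ne_zero (Finset.mem_range.1 hj)
  have h3 : ∑ i ∈ Finset.range (b + 1),
      (orderAt ((oddIndex b i : 𝕜) / 2) 0 (curvePoly 𝕜 b k) : ℤ) ≤ b := by
    rw [← Finset.add_sum_erase _ _ (Finset.mem_range.2 (Nat.lt_succ_of_le hk)),
      orderAt_eq_zero (by
        rw [hval, mul_zero, zero_add]; exact oddPoly_eval_self_ne_zero hk)]
    have : ∀ i ∈ (Finset.range (b + 1)).erase k,
        (orderAt ((oddIndex b i : 𝕜) / 2) 0 (curvePoly 𝕜 b k) : ℤ) ≤ 1 := by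
      intro i hi
      exact_mod_cast hle _ _ (by
        rw [eval_sub, oddPoly_eval_oddIndex hi, sub_zero]
        exact rowPoly_eval_oddIndex_ne_zero
          (Nat.lt_succ_iff.1 (Finset.mem_range.1 (Finset.mem_of_mem_erase hi))))
    simpa [Finset.card_erase_of_mem, Nat.lt_succ_of_le hk] using
      Finset.sum_le_card_nsmul _ _ _ this
  rw [defect, h2, hdeg]
  have hbZ : (2 : ℤ) ≤ b := by exact_mod_cast hb
  have htdZ : (b : ℤ) ≤ biTotalDegree (curvePoly 𝕜 b k) := by exact_mod_cast htd
  have e1 := mul_le_mul_of_nonneg_left htdZ (by positivity : (0 : ℤ) ≤ 2 * b ^ 2)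
  have e2 := mul_le_mul_of_nonneg_left h1 (by nlinarith : (0 : ℤ) ≤ 2 * b ^ 2 - 1)
  have e3 := mul_le_mul_of_nonneg_left h3 (by nlinarith : (0 : ℤ) ≤ 2 * b ^ 2 - 2 * b)
  push_cast
  linarith

theorem defect_nonneg_of_not_dvd {b : ℕ} (hb : 2 ≤ b) {G : 𝕜[X][X]}
    (hline : ∀ j < b, ¬ C (X - C (j : 𝕜)) ∣ G) (hcurve : ∀ k ≤ b, ¬ curvePoly 𝕜 b k ∣ G) :
    0 ≤ defect b G := by
  set A := ∑ j ∈ Finset.range b, (orderAt (j : 𝕜) 1 G : ℤ) with hA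
  set E := ∑ j ∈ Finset.range b, (orderAt (j : 𝕜) 0 G : ℤ) with hE
  set O := ∑ i ∈ Finset.range (b + 1), (orderAt ((oddIndex b i : 𝕜) / 2) 0 G : ℤ) with hO
  have h1 : A + E ≤ b * G.natDegree := by
    rw [hA, hE, ← Finset.sum_add_distrib]
    have : ∀ j ∈ Finset.range b, (orderAt (j : 𝕜) 1 G : ℤ) + orderAt (j : 𝕜) 0 G
        ≤ G.natDegree := fun j hj => by
      exact_mod_cast orderAt_add_orderAt_le (fun h => hline j (Finset.mem_range.1 hj)
        (C_X_sub_C_dvd h)) one_ne_zero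
    simpa using Finset.sum_le_card_nsmul _ _ _ this
  have h2 : ∀ k ∈ Finset.range (b + 1), A + (O - orderAt ((oddIndex b k : 𝕜) / 2) 0 G) ≤
      biTotalDegree G + (b - 1) * G.natDegree := by
    intro k hk
    have hk' : k ≤ b := Nat.lt_succ_iff.1 (Finset.mem_range.1 hk)
    -- The points on the curve lie at two heights, but their slopes are pairwise distinct, which is
    -- what Bezout on a graph needs.
    have hinj : Set.InjOn (Sum.elim (fun j : ℕ => (j : 𝕜)) fun i => (oddIndex b i : 𝕜) / 2)
        ((Finset.range b).disjSum ((Finset.range (b + 1)).erase k)) := by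
      rintro (x | x) hx (y | y) hy hxy
      · simpa using hxy
      · simp only [Finset.mem_coe, Finset.inl_mem_disjSum, Finset.inr_mem_disjSum] at hx hy
        exact absurd hxy.symm (oddIndex_div_two_ne
          (Nat.lt_succ_iff.1 (Finset.mem_range.1 (Finset.mem_of_mem_erase hy)))
          (Finset.mem_range.1 hx))
      · simp only [Finset.mem_coe, Finset.inl_mem_disjSum, Finset.inr_mem_disjSum] at hx hy
        exact absurd hxy (oddIndex_div_two_ne
          (Nat.lt_succ_iff.1 (Finset.mem_range.1 (Finset.mem_of_mem_erase hx)))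
          (Finset.mem_range.1 hy))
      · simp only [Finset.mem_coe, Finset.inr_mem_disjSum] at hx hy
        rw [oddIndex_div_two_injOn b (Finset.mem_of_mem_erase hx) (Finset.mem_of_mem_erase hy) hxy]
    have hcop : IsCoprime (rowPoly 𝕜 b - oddPoly 𝕜 b k) (oddPoly 𝕜 b k) := by
      rw [sub_eq_add_neg, ← mul_neg_one]
      exact isCoprime_rowPoly_oddPoly.add_mul_left_left _
    have := sum_orderAt_le hinj (b := Sum.elim (fun _ => (1 : 𝕜)) fun _ => 0)
      (natDegree_rowPoly_sub_oddPoly_le hk')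
      ((natDegree_oddPoly hk').le.trans (by omega))
      (by
        rintro (j | i) h
        · rw [Finset.inl_mem_disjSum, Finset.mem_range] at h
          simpa [rowPoly_eval_natCast h] using oddPoly_eval_natCast_ne_zero h
        · rw [Finset.inr_mem_disjSum] at h
          simpa [oddPoly_eval_oddIndex h] using rowPoly_eval_oddIndex_ne_zero
            (Nat.lt_succ_iff.1 (Finset.mem_range.1 (Finset.mem_of_mem_erase h))))
      (by
        rintro (j | i) h
        · rw [Finset.inl_mem_disjSum, Finset.mem_range] at h
          simp [rowPoly_eval_natCast h]
        · rw [Finset.inr_mem_disjSum] at h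
          simp [oddPoly_eval_oddIndex h])
      (G := G) (fun h => hcurve k hk'
        (C_mul_X_add_C_dvd (rowPoly_sub_oddPoly_ne_zero (by omega)) hcop h))
    rw [Finset.sum_disjSum] at this
    simp only [Sum.elim_inl, Sum.elim_inr] at this
    have hb1 : ((b - 1 : ℕ) : ℤ) = b - 1 := by rw [Nat.cast_sub (by omega)]; simp
    rw [hO, hA, ← Finset.add_sum_erase _ _ hk, add_sub_cancel_left, ← hb1]
    exact_mod_cast this
  -- Sum over `k`: each special point is omitted by exactly one of the `b + 1` curves.
  have h3 : (b + 1) * A + b * O ≤ (b + 1) * (biTotalDegree G + (b - 1) * G.natDegree) := by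
    have := Finset.sum_le_sum h2
    simp only [Finset.sum_add_distrib, Finset.sum_sub_distrib, Finset.sum_const, ← hO,
      Finset.card_range, nsmul_eq_mul, Nat.cast_add, Nat.cast_one] at this
    linarith
  have h4 : (G.natDegree : ℤ) ≤ biTotalDegree G := by exact_mod_cast natDegree_le_biTotalDegree G
  have hbZ : (2 : ℤ) ≤ b := by exact_mod_cast hb
  -- With weight `2b - 2`, adding `h1` produces the coefficients `2b² - 1`, `1` and `2b² - 2b` of
  -- the defect; the degree terms then fall short of those in the defect by twice the difference in
  -- `h4`.
  have h5 := mul_le_mul_of_nonneg_left h3 (by linarith : (0 : ℤ) ≤ 2 * b - 2)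
  rw [defect, ← hA, ← hE, ← hO]
  linarith

/-- Split off a line or curve component as long as there is one: the defect is additive and the
total degree drops. -/
theorem defect_nonneg {b : ℕ} (hb : 2 ≤ b) (G : 𝕜[X][X]) (hG : G ≠ 0) : 0 ≤ defect b G := by
  induction h : biTotalDegree G using Nat.strong_induction_on generalizing G with
  | _ n ih =>
    have step : ∀ F : 𝕜[X][X], 0 < biTotalDegree F → 0 ≤ defect b F → F ∣ G → 0 ≤ defect b G := by
      rintro F hF hdF ⟨H, rfl⟩
      have hF0 := left_ne_zero_of_mul hG
      have hH0 := right_ne_zero_of_mul hG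
      rw [biTotalDegree_mul hF0 hH0] at h
      rw [defect_mul b hF0 hH0]
      exact add_nonneg hdF (ih _ (by omega) H hH0 rfl)
    by_cases hline : ∃ j < b, C (X - C (j : 𝕜)) ∣ G
    · obtain ⟨j, hj, hd⟩ := hline
      exact step _ (one_le_biTotalDegree_C_X_sub_C _) (defect_line_nonneg hj) hd
    by_cases hcurve : ∃ k ≤ b, curvePoly 𝕜 b k ∣ G
    · obtain ⟨k, hk, hd⟩ := hcurve
      refine step _ ?_ (defect_curvePoly_nonneg hb hk) hd
      refine lt_of_lt_of_le ?_ (natDegree_le_biTotalDegree _)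
      rw [curvePoly, natDegree_linear (rowPoly_sub_oddPoly_ne_zero (by omega))]
      exact one_pos
    push Not at hline hcurve
    exact defect_nonneg_of_not_dvd hb hline hcurve

end Configuration

/-! ### Passage to the chart and the lower bound -/

section LowerBound

open Polynomial

variable {𝕜 : Type*} [Field 𝕜]

/-- Dehomogenization with respect to `2 * x₀ - x₂`, in the coordinates slope and height as seen from
the point `[1 : 0 : 2]`. -/
noncomputable def toChart (𝕜 : Type*) [Field 𝕜] : MvPolynomial (Fin 3) 𝕜 →ₐ[𝕜] 𝕜[X][X] :=
  MvPolynomial.aeval ![algebraMap 𝕜 _ (1 / 2) * (1 + X), C X, X]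

theorem biTotalDegree_toChart_le {f : MvPolynomial (Fin 3) 𝕜} {n : ℕ} (hf : f.IsHomogeneous n) :
    biTotalDegree (toChart 𝕜 f) ≤ n := by
  have h : (biSubst (X : 𝕜[X][X]) (C X * X)).comp (toChart 𝕜) =
      MvPolynomial.aeval ![algebraMap 𝕜 _ (1 / 2) * (1 + C X * X), X, C X * X] := by
    refine MvPolynomial.algHom_ext fun i => ?_
    fin_cases i
    · simp [toChart, aeval_C]
    · simp [toChart]
    · simp [toChart]
  have h2 := DFunLike.congr_fun h f
  rw [AlgHom.comp_apply, ← MvPolynomial.aeval_map_algebraMap 𝕜[X]] at h2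
  rw [biTotalDegree, h2, ← mul_one n]
  refine MvPolynomial.aeval_natDegree_le _ ?_ _ ?_
  · exact (hf.map _).totalDegree_le
  · intro i
    fin_cases i
    · simp only [IsScalarTower.algebraMap_apply 𝕜 𝕜[X] 𝕜[X][X], algebraMap_eq]
      show (C (C (1 / 2 : 𝕜)) * (1 + C X * X) : 𝕜[X][X]).natDegree ≤ 1
      compute_degree
    · show (X : 𝕜[X][X]).natDegree ≤ 1
      compute_degree
    · show (C X * X : 𝕜[X][X]).natDegree ≤ 1
      compute_degree

/-- By homogeneity, the chart determines the values of `f` off the line `2x₀ = x₂`; hence a zero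
image would make `(2x₀ - x₂) f` vanish everywhere. -/
theorem toChart_ne_zero [CharZero 𝕜] {f : MvPolynomial (Fin 3) 𝕜} {n : ℕ} (hf : f.IsHomogeneous n)
    (h0 : f ≠ 0) : toChart 𝕜 f ≠ 0 := by
  intro h
  have hy : (MvPolynomial.C 2 * MvPolynomial.X 0 - MvPolynomial.X 2 :
      MvPolynomial (Fin 3) 𝕜) ≠ 0 := by
    intro h
    have := congrArg (MvPolynomial.eval ![1, 0, 0]) h
    simp at this
  refine mul_ne_zero hy h0 (MvPolynomial.funext fun x => ?_)
  rw [map_mul, map_zero, mul_eq_zero]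
  by_cases hx : 2 * x 0 - x 2 = 0
  · left; simpa using hx
  right
  have hcomp : (biSubst (x 1 / (2 * x 0 - x 2)) (x 2 / (2 * x 0 - x 2))).comp (toChart 𝕜) =
      MvPolynomial.aeval fun i => (2 * x 0 - x 2)⁻¹ * x i := by
    refine MvPolynomial.algHom_ext fun i => ?_
    fin_cases i
    · simp only [toChart, AlgHom.comp_apply, MvPolynomial.aeval_X]
      simp
      field_simp
      ring
    · simp [toChart]; ring
    · simp [toChart]; ring
  have h2 := DFunLike.congr_fun hcomp f
  rw [AlgHom.comp_apply, h, map_zero, aeval_const_mul_of_isHomogeneous hf, eq_comm,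
    mul_eq_zero, or_iff_right (pow_ne_zero _ (inv_ne_zero hx)), MvPolynomial.aeval_eq_eval] at h2
  exact h2

/-- The polynomial `g` is `f` in the chart `x₂ = 1` of the blow-up at the apex, where `s = 2x₀ - x₂
= 1/y` and `x₁ = s x`. By homogeneity the two charts are related by `y^n g(x, 1/y)`. A field `K`
makes `1/y` available. -/
theorem toChart_eq_reflect {f : MvPolynomial (Fin 3) 𝕜} {n : ℕ} (hf : f.IsHomogeneous n)
    {g : 𝕜[X][X]} (hgdeg : g.natDegree ≤ n)
    (hg : g = MvPolynomial.aeval ![algebraMap 𝕜 𝕜[X][X] (1 / 2) * (1 + X), X * C X, 1] f)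
    {K : Type*} [Field K] [Algebra 𝕜 K] {ι : 𝕜[X][X] →ₐ[𝕜] K} (hι : Function.Injective ι) :
    toChart 𝕜 f = reflect n g := by
  have hz : ι X ≠ 0 := by
    rw [Ne, map_eq_zero_iff _ hι]; exact X_ne_zero
  have hid : ∀ G, biSubst (ι (C X)) (ι X) G = ι G := by
    intro G
    rw [← map_biSubst]
    rw [biSubst_C_X_X]; rfl
  have e1 : biSubst (ι (C X)) (ι X)⁻¹ g = MvPolynomial.aeval
      ![algebraMap 𝕜 K (1 / 2) * (1 + (ι X)⁻¹), (ι X)⁻¹ * ι (C X), 1] f := by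
    rw [hg, ← AlgHom.comp_apply]
    congr 1
    refine MvPolynomial.algHom_ext fun i => ?_
    fin_cases i
    · simp only [AlgHom.comp_apply, MvPolynomial.aeval_X]
      show biSubst _ _ (algebraMap 𝕜 𝕜[X][X] (1 / 2) * (1 + X)) = _
      rw [map_mul, AlgHom.commutes, map_add, map_one, biSubst_X]
      rfl
    · simp only [AlgHom.comp_apply, MvPolynomial.aeval_X]
      simp
      exact mul_comm _ _
    · simp
  have e2 : ι (toChart 𝕜 f) = ι X ^ n * MvPolynomial.aeval
      ![algebraMap 𝕜 K (1 / 2) * (1 + (ι X)⁻¹), (ι X)⁻¹ * ι (C X), 1] f := by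
    rw [← aeval_const_mul_of_isHomogeneous hf, toChart, ← AlgHom.comp_apply]
    congr 1
    refine MvPolynomial.algHom_ext fun i => ?_
    fin_cases i
    · simp only [AlgHom.comp_apply, MvPolynomial.aeval_X]
      show ι (algebraMap 𝕜 𝕜[X][X] (1 / 2) * (1 + X)) =
        ι X * (algebraMap 𝕜 K (1 / 2) * (1 + (ι X)⁻¹))
      rw [map_mul, AlgHom.commutes, map_add, map_one]
      field_simp
      ring
    · simp [hz]
    · simp
  apply hι
  let : Invertible (ι X)⁻¹ := invertibleOfNonzero (inv_ne_zero hz)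
  have h := eval₂_reflect_mul_pow (aeval (ι (C X)) : 𝕜[X] →ₐ[𝕜] K).toRingHom (ι X)⁻¹ n g hgdeg
  rw [invOf_eq_inv, inv_inv, ← biSubst_apply, ← biSubst_apply, hid, e1] at h
  rw [e2, ← h, mul_left_comm, ← mul_pow, mul_inv_cancel₀ hz, one_pow, mul_one]

/-- A factor `s^t` at the apex becomes, after reflection, a drop of `t` in the `y`-degree. -/
theorem natDegree_toChart_add_le [CharZero 𝕜] {f : MvPolynomial (Fin 3) 𝕜} {n t : ℕ}
    (hf : f.IsHomogeneous n) (hf0 : f ≠ 0)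
    (hd : X ^ t ∣ MvPolynomial.aeval
      ![algebraMap 𝕜 𝕜[X][X] (1 / 2) * (1 + X), X * C X, 1] f) :
    (toChart 𝕜 f).natDegree + t ≤ n := by
  set g := MvPolynomial.aeval ![algebraMap 𝕜 𝕜[X][X] (1 / 2) * (1 + X), X * C X, 1] f with hg
  have hgdeg : g.natDegree ≤ n := by
    rw [hg, ← MvPolynomial.aeval_map_algebraMap 𝕜[X], ← mul_one n]
    refine MvPolynomial.aeval_natDegree_le _ (hf.map _).totalDegree_le _ ?_
    intro i
    fin_cases i
    · simp only [IsScalarTower.algebraMap_apply 𝕜 𝕜[X] 𝕜[X][X], algebraMap_eq]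
      show (C (C (1 / 2 : 𝕜)) * (1 + X) : 𝕜[X][X]).natDegree ≤ 1
      compute_degree
    · show (X * C X : 𝕜[X][X]).natDegree ≤ 1
      compute_degree
    · show (1 : 𝕜[X][X]).natDegree ≤ 1
      simp
  have e := toChart_eq_reflect hf hgdeg hg
    (ι := IsScalarTower.toAlgHom 𝕜 𝕜[X][X] (FractionRing 𝕜[X][X])) (IsFractionRing.injective _ _)
  have hg0 : g ≠ 0 := fun h => toChart_ne_zero hf hf0 (by rw [e, h, reflect_zero])
  have htn : t ≤ n := by
    have := natDegree_le_of_dvd hd hg0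
    rw [natDegree_X_pow] at this
    omega
  rw [← Nat.le_sub_iff_add_le htn, e, natDegree_le_iff_coeff_eq_zero]
  intro c hc
  rw [coeff_reflect]
  by_cases hcn : c ≤ n
  · rw [revAt_le hcn]
    exact X_pow_dvd_iff.1 hd _ (by omega)
  · rw [revAt_eq_self_of_lt (by omega)]
    exact coeff_eq_zero_of_natDegree_lt (by omega)

/-- The factor `(1 + β)/2` rescales `[1 : a : c]` to the representative with `2x₀ - x₂ = 1`, whose
chart coordinates are `(α, β)`. -/
theorem le_orderAt_toChart {X : Set (ℙ 𝕜 (Fin 3 → 𝕜))} (hX : X.Finite) {t : ℕ}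
    {f : MvPolynomial (Fin 3) 𝕜} (hf : f ∈ symbolicPower (vanishingIdealP2 X) t)
    (h0 : toChart 𝕜 f ≠ 0) {a c α β : 𝕜} (hP : affinePointP2 a c ∈ X)
    (hα : a * ((1 + β) / 2) = α) (hβ : c * ((1 + β) / 2) = β) :
    t ≤ orderAt α β (toChart 𝕜 f) := by
  apply le_orderAt h0
  have h := pow_dvd_aeval_of_mem_symbolicPower hX hf _ hP
    (algebraMap 𝕜 (MvPolynomial (Fin 2) 𝕜)[X] ((1 + β) / 2)) Polynomial.X
    ![algebraMap 𝕜 _ (1 / 2) * C (MvPolynomial.X 1), C (MvPolynomial.X 0), C (MvPolynomial.X 1)]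
  convert h using 1
  rw [← AlgHom.comp_apply]
  congr 1
  refine MvPolynomial.algHom_ext fun i => ?_
  simp only [AlgHom.comp_apply, MvPolynomial.aeval_X, toChart, localExpansion, ← map_mul]
  fin_cases i
  · show biSubst _ _ (algebraMap 𝕜 𝕜[X][X] (1 / 2) * (1 + Polynomial.X)) = algebraMap 𝕜 _ (1 * _) +
      Polynomial.X * (algebraMap 𝕜 _ (1 / 2) * C (MvPolynomial.X 1))
    rw [map_mul, AlgHom.commutes, map_add, map_one, biSubst_X, one_mul, add_div, map_add,
      div_eq_mul_one_div β, map_mul]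
    ring
  · show biSubst _ _ (C Polynomial.X) = algebraMap 𝕜 _ (a * _) +
      Polynomial.X * C (MvPolynomial.X 0)
    rw [hα, biSubst_C, aeval_X]
  · show biSubst _ _ Polynomial.X = algebraMap 𝕜 _ (c * _) +
      Polynomial.X * C (MvPolynomial.X 1)
    rw [hβ, biSubst_X]

theorem mem_standardConfiguration_iff {b : ℕ} {P : ℙ 𝕜 (Fin 3 → 𝕜)} :
    P ∈ standardConfiguration 𝕜 ![1, b, 2 * b + 1] ↔ P = affinePointP2 0 2 ∨
      (∃ j < b, P = affinePointP2 (j : 𝕜) 1) ∨ ∃ j < 2 * b + 1, P = affinePointP2 (j : 𝕜) 0 := by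
  have h2 : (3 : 𝕜) - 1 = 2 := by norm_num
  have h1 : (3 : 𝕜) - (1 + 1) = 1 := by norm_num
  have h0 : (3 : 𝕜) - (1 + 1 + 1) = 0 := by norm_num
  simp [standardConfiguration, Fin.exists_fin_succ, h2, h1, h0]

theorem finite_standardConfiguration {s : ℕ} (d : Fin s → ℕ) :
    (standardConfiguration 𝕜 d).Finite := by
  refine (Set.finite_iUnion fun i : Fin s => (Set.finite_Iio (d i)).image fun j : ℕ =>
    affinePointP2 (j : 𝕜) ((s : 𝕜) - (((i : ℕ) : 𝕜) + 1))).subset ?_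
  rintro P ⟨i, j, hj, rfl⟩
  exact Set.mem_iUnion.2 ⟨i, j, hj, rfl⟩

theorem mul_le_mul_degree_of_mem_symbolicPower [CharZero 𝕜] {b t n : ℕ} (hb : 2 ≤ b)
    {f : MvPolynomial (Fin 3) 𝕜} (hf : f.IsHomogeneous n) (hf0 : f ≠ 0)
    (hft : f ∈ symbolicPower
      (vanishingIdealP2 (standardConfiguration 𝕜 ![1, b, 2 * b + 1])) t) :
    (6 * b ^ 2 - 2 * b - 3 : ℤ) * t ≤ (2 * b ^ 2 - 1) * n := by
  have hX := finite_standardConfiguration (𝕜 := 𝕜) ![1, b, 2 * b + 1]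
  have hG := toChart_ne_zero hf hf0
  have htd : (biTotalDegree (toChart 𝕜 f) : ℤ) ≤ n := by exact_mod_cast biTotalDegree_toChart_le hf
  have hdvd : X ^ t ∣ MvPolynomial.aeval
      ![algebraMap 𝕜 𝕜[X][X] (1 / 2) * (1 + X), X * C X, 1] f := by
    have h := pow_dvd_aeval_of_mem_symbolicPower hX hft _
      (mem_standardConfiguration_iff.2 (Or.inl rfl))
      (algebraMap 𝕜 𝕜[X][X] (1 / 2)) X ![algebraMap 𝕜 𝕜[X][X] (1 / 2), C X, 0]
    have hv : (fun i => algebraMap 𝕜 𝕜[X][X] (![1, 0, 2] i) * algebraMap 𝕜 𝕜[X][X] (1 / 2) +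
        X * ![algebraMap 𝕜 𝕜[X][X] (1 / 2), C X, 0] i) =
        ![algebraMap 𝕜 𝕜[X][X] (1 / 2) * (1 + X), X * C X, 1] := by
      funext i
      rw [← map_mul]
      fin_cases i
      · show algebraMap 𝕜 𝕜[X][X] (1 * (1 / 2)) + X * algebraMap 𝕜 𝕜[X][X] (1 / 2) =
          algebraMap 𝕜 𝕜[X][X] (1 / 2) * (1 + X)
        rw [one_mul]; ring
      · simp
      · simp
    rwa [hv] at h
  have hdz : ((toChart 𝕜 f).natDegree : ℤ) ≤ n - t := by
    have := natDegree_toChart_add_le hf hf0 hdvd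
    omega
  have h1 : (b : ℤ) * t ≤ ∑ j ∈ Finset.range b, (orderAt (j : 𝕜) 1 (toChart 𝕜 f) : ℤ) := by
    have : ∀ j ∈ Finset.range b, (t : ℤ) ≤ orderAt (j : 𝕜) 1 (toChart 𝕜 f) := fun j hj => by
      exact_mod_cast le_orderAt_toChart hX hft hG (a := j) (c := 1)
        (mem_standardConfiguration_iff.2 (Or.inr (Or.inl ⟨j, Finset.mem_range.1 hj, rfl⟩)))
        (by ring) (by ring)
    simpa using Finset.card_nsmul_le_sum _ _ _ this
  have h2 : (b : ℤ) * t ≤ ∑ j ∈ Finset.range b, (orderAt (j : 𝕜) 0 (toChart 𝕜 f) : ℤ) := by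
    have : ∀ j ∈ Finset.range b, (t : ℤ) ≤ orderAt (j : 𝕜) 0 (toChart 𝕜 f) := fun j hj => by
      have hj := Finset.mem_range.1 hj
      -- On the long row the slope is half the index, so slope `j` belongs to the point of index
      -- `2j`.
      exact_mod_cast le_orderAt_toChart hX hft hG (a := (2 * j : ℕ)) (c := 0)
        (mem_standardConfiguration_iff.2 (Or.inr (Or.inr ⟨2 * j, by omega, rfl⟩)))
        (by push_cast; ring) (by ring)
    simpa using Finset.card_nsmul_le_sum _ _ _ this
  have h3 : (b + 1 : ℤ) * t ≤ ∑ i ∈ Finset.range (b + 1),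
      (orderAt ((oddIndex b i : 𝕜) / 2) 0 (toChart 𝕜 f) : ℤ) := by
    have : ∀ i ∈ Finset.range (b + 1),
        (t : ℤ) ≤ orderAt ((oddIndex b i : 𝕜) / 2) 0 (toChart 𝕜 f) := fun i hi => by
      exact_mod_cast le_orderAt_toChart hX hft hG (a := oddIndex b i) (c := 0)
        (mem_standardConfiguration_iff.2 (Or.inr (Or.inr
          ⟨oddIndex b i, by unfold oddIndex; omega, rfl⟩)))
        (by ring) (by ring)
    simpa using Finset.card_nsmul_le_sum _ _ _ this
  have hdef := defect_nonneg hb _ hG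
  rw [defect] at hdef
  have hbZ : (2 : ℤ) ≤ b := by exact_mod_cast hb
  have e1 := mul_le_mul_of_nonneg_left htd (by positivity : (0 : ℤ) ≤ 2 * b ^ 2)
  have e2 := mul_le_mul_of_nonneg_left hdz
    (by nlinarith : (0 : ℤ) ≤ 2 * b ^ 3 - 2 * b ^ 2 - b)
  have e3 := mul_le_mul_of_nonneg_left h1 (by nlinarith : (0 : ℤ) ≤ 2 * b ^ 2 - 1)
  have e4 := mul_le_mul_of_nonneg_left h3 (by nlinarith : (0 : ℤ) ≤ 2 * b ^ 2 - 2 * b)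
  refine le_of_mul_le_mul_left (a := (b : ℤ)) ?_ (by linarith)
  linarith

end LowerBound

/-! ### An explicit form attaining the ratio -/

section UpperBound

open MvPolynomial

variable {𝕜 : Type*} [Field 𝕜]

theorem mem_pointIdeal_affinePointP2_rep {f : MvPolynomial (Fin 3) 𝕜} {n : ℕ}
    (hf : f.IsHomogeneous n) (a c : 𝕜) :
    f ∈ pointIdeal (affinePointP2 a c).rep ↔ eval ![1, a, c] f = 0 := by
  obtain ⟨u, hu⟩ := Projectivization.exists_smul_eq_mk_rep 𝕜 ![1, a, c]
    (fun h => one_ne_zero (congrFun h 0))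
  rw [affinePointP2, ← hu, Units.smul_def, pointIdeal_smul u.ne_zero,
    mem_pointIdeal_of_isHomogeneous hf]

/-- The form `2 * x₀ - x₂`, which together with `x₁` generates the ideal of `[1 : 0 : 2]`. -/
noncomputable def apexForm (𝕜 : Type*) [Field 𝕜] : MvPolynomial (Fin 3) 𝕜 := C 2 * X 0 - X 2

theorem apexForm_isHomogeneous : (apexForm 𝕜).IsHomogeneous 1 :=
  (isHomogeneous_C_mul_X _ _).sub (isHomogeneous_X _ _)

/-- The line of slope `a` through `[1 : 0 : 2]`. -/
noncomputable def slopeForm (a : 𝕜) : MvPolynomial (Fin 3) 𝕜 := X 1 - C a * apexForm 𝕜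

theorem slopeForm_isHomogeneous (a : 𝕜) : (slopeForm a).IsHomogeneous 1 :=
  (isHomogeneous_X _ _).sub (by simpa using (isHomogeneous_C _ a).mul apexForm_isHomogeneous)

@[simp] theorem eval_apexForm (v : Fin 3 → 𝕜) : eval v (apexForm 𝕜) = 2 * v 0 - v 2 := by
  simp [apexForm]

@[simp] theorem eval_slopeForm (a : 𝕜) (v : Fin 3 → 𝕜) :
    eval v (slopeForm a) = v 1 - a * (2 * v 0 - v 2) := by
  simp [slopeForm]

theorem prod_slopeForm_isHomogeneous {ι : Type*} (S : Finset ι) (a : ι → 𝕜) :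
    (∏ i ∈ S, slopeForm (a i)).IsHomogeneous S.card := by
  simpa using IsHomogeneous.prod S _ (fun _ => 1) fun i _ => slopeForm_isHomogeneous (a i)

theorem X_one_mem_apex : (X 1 : MvPolynomial (Fin 3) 𝕜) ∈
    pointIdeal (affinePointP2 (0 : 𝕜) 2).rep :=
  (mem_pointIdeal_affinePointP2_rep (isHomogeneous_X _ _) _ _).2 (by simp)

theorem slopeForm_mem_apex (a : 𝕜) : slopeForm a ∈ pointIdeal (affinePointP2 (0 : 𝕜) 2).rep :=
  (mem_pointIdeal_affinePointP2_rep (slopeForm_isHomogeneous a) _ _).2 (by simp)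

theorem prod_mem_pow {R ι : Type*} [CommRing R] {I : Ideal R} (S : Finset ι) {f : ι → R}
    (hf : ∀ i ∈ S, f i ∈ I) : ∏ i ∈ S, f i ∈ I ^ S.card := by
  simpa using Ideal.prod_mem_prod (I := fun _ => I) hf

theorem mul_mem_pow_add {R : Type*} [CommRing R] {I : Ideal R} {x y : R} {m n : ℕ}
    (hx : x ∈ I ^ m) (hy : y ∈ I ^ n) : x * y ∈ I ^ (m + n) := by
  rw [pow_add]; exact Ideal.mul_mem_mul hx hy

/-- A product of lines through the apex agrees with a power of `x₁` up to a multiple of the form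
`2 * x₀ - x₂`. -/
theorem exists_prod_slopeForm_eq {ι : Type*} {S : Finset ι} (hS : S.Nonempty) (a : ι → 𝕜) :
    ∃ F : MvPolynomial (Fin 3) 𝕜, F.IsHomogeneous (S.card - 1) ∧
      F ∈ pointIdeal (affinePointP2 (0 : 𝕜) 2).rep ^ (S.card - 1) ∧
      ∏ i ∈ S, slopeForm (a i) = X 1 ^ S.card - apexForm 𝕜 * F := by
  induction hS using Finset.Nonempty.cons_induction with
  | singleton i =>
    refine ⟨C (a i), by simpa using isHomogeneous_C _ _, by simp, ?_⟩
    simp [slopeForm, mul_comm]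
  | cons i S hi hS ih =>
    obtain ⟨F, hF, hmem, heq⟩ := ih
    have hc : S.card - 1 + 1 = S.card := Nat.succ_pred_eq_of_pos hS.card_pos
    refine ⟨X 1 * F + C (a i) * ∏ j ∈ S, slopeForm (a j), ?_, ?_, ?_⟩
    · rw [Finset.card_cons, Nat.add_sub_cancel]
      refine IsHomogeneous.add ?_ ?_
      · have := (isHomogeneous_X 𝕜 (1 : Fin 3)).mul hF
        rwa [add_comm, hc] at this
      · simpa using (isHomogeneous_C _ (a i)).mul (prod_slopeForm_isHomogeneous S a)
    · rw [Finset.card_cons, Nat.add_sub_cancel]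
      refine Ideal.add_mem _ ?_ (Ideal.mul_mem_left _ _ (prod_mem_pow S fun j _ =>
        slopeForm_mem_apex (a j)))
      have := mul_mem_pow_add hmem (y := X 1) (n := 1) (by rw [pow_one]; exact X_one_mem_apex)
      rwa [hc, mul_comm] at this
    · rw [Finset.prod_cons, Finset.card_cons, mul_add, pow_succ]
      rw [slopeForm, sub_mul]
      nth_rewrite 1 [heq]
      ring

/-- The homogeneous form of `curvePoly`. -/
theorem exists_curveForm [CharZero 𝕜] {b k : ℕ} (hb : 0 < b) (hk : k ≤ b) :
    ∃ D : MvPolynomial (Fin 3) 𝕜, D.IsHomogeneous b ∧ D ≠ 0 ∧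
      D ∈ pointIdeal (affinePointP2 (0 : 𝕜) 2).rep ^ (b - 1) ∧
      (∀ j < b, D ∈ pointIdeal (affinePointP2 (j : 𝕜) 1).rep) ∧
      ∀ i ≤ b, i ≠ k → D ∈ pointIdeal (affinePointP2 (oddIndex b i : 𝕜) 0).rep := by
  obtain ⟨F₁, hF₁, hm₁, he₁⟩ := exists_prod_slopeForm_eq
    (Finset.nonempty_range_iff.2 hb.ne') (fun j : ℕ => (j : 𝕜))
  have hcard : ((Finset.range (b + 1)).erase k).card = b := by
    simp [Finset.card_erase_of_mem, Nat.lt_succ_of_le hk]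
  obtain ⟨F₂, hF₂, hm₂, he₂⟩ := exists_prod_slopeForm_eq
    (Finset.card_pos.1 (by omega : 0 < ((Finset.range (b + 1)).erase k).card))
    (fun i : ℕ => (oddIndex b i : 𝕜) / 2)
  have hg := prod_slopeForm_isHomogeneous ((Finset.range (b + 1)).erase k)
    (fun i : ℕ => (oddIndex b i : 𝕜) / 2)
  rw [Finset.card_range] at hF₁ hm₁ he₁
  rw [hcard] at hF₂ hm₂ he₂ hg
  set g := ∏ i ∈ (Finset.range (b + 1)).erase k, slopeForm ((oddIndex b i : 𝕜) / 2) with hgdef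
  have hb1 : 1 + (b - 1) = b := by omega
  have hD : (X 2 * (F₂ - F₁) + g).IsHomogeneous b := by
    refine IsHomogeneous.add ?_ hg
    have := (isHomogeneous_X 𝕜 (2 : Fin 3)).mul (hF₂.sub hF₁)
    rwa [hb1] at this
  -- With `h = 2x₀ - x₂` and `R`, `g` the products of row and special lines, `F₂ - F₁ = (R - g)/h`,
  -- since the powers of `x₁` cancel. So this form homogenizes `(R - g) y + g` with `y = x₂/h`.
  refine ⟨X 2 * (F₂ - F₁) + g, hD, ?_, ?_, fun j hj => ?_, fun i hi hik => ?_⟩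
  -- The omitted `k`-th point lies on `x₂ = 0`, where the form reduces to `g`, and no factor of `g`
  -- vanishes there.
  · intro h
    have h2 := congrArg (eval ![1, (oddIndex b k : 𝕜), 0]) h
    simp only [hgdef, map_add, map_mul, eval_X, map_prod, eval_slopeForm] at h2
    simp only [Matrix.cons_val, zero_mul, zero_add, map_zero, Finset.prod_eq_zero_iff] at h2
    obtain ⟨i, hi, hik⟩ := h2
    have := oddIndex_injOn b (Finset.mem_of_mem_erase hi)
      (Finset.mem_coe.2 (Finset.mem_range.2 (Nat.lt_succ_of_le hk)))
      (Nat.cast_injective (R := 𝕜) (by linear_combination -hik))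
    exact Finset.ne_of_mem_erase hi this
  · refine Ideal.add_mem _ (Ideal.mul_mem_left _ _ (Ideal.sub_mem _ hm₂ hm₁)) ?_
    refine Ideal.pow_le_pow_right (by omega : b - 1 ≤ b) ?_
    have := prod_mem_pow ((Finset.range (b + 1)).erase k)
      fun i _ => slopeForm_mem_apex ((oddIndex b i : 𝕜) / 2)
    rwa [hcard] at this
  · rw [mem_pointIdeal_affinePointP2_rep hD]
    have h1 := congrArg (eval ![1, (j : 𝕜), 1]) he₁
    have h2 := congrArg (eval ![1, (j : 𝕜), 1]) he₂
    rw [map_prod, Finset.prod_eq_zero (Finset.mem_range.2 hj) (by simp; ring)] at h1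
    simp only [map_sub, map_mul, map_pow, eval_X, eval_apexForm, map_add] at h1 h2 ⊢
    simp only [Matrix.cons_val] at h1 h2 ⊢
    linear_combination h2 - h1
  · rw [mem_pointIdeal_affinePointP2_rep hD, map_add, map_mul, eval_X, hgdef, map_prod,
      Finset.prod_eq_zero (i := i) (by simp [hik, Nat.lt_succ_of_le hi])]
    · simp
    · simp

theorem exists_form_mem_pointIdeal_pow [CharZero 𝕜] {b : ℕ} (hb : 2 ≤ b) :
    ∃ F : MvPolynomial (Fin 3) 𝕜, F.IsHomogeneous (6 * b ^ 2 - 2 * b - 3) ∧ F ≠ 0 ∧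
      ∀ P ∈ standardConfiguration 𝕜 ![1, b, 2 * b + 1],
        F ∈ pointIdeal P.rep ^ (2 * b ^ 2 - 1) := by
  choose! D hDhom hD0 hDapex hDmid hDodd using
    fun k (hk : k ≤ b) => exists_curveForm (𝕜 := 𝕜) (by omega : 0 < b) hk
  have hle : ∀ {k}, k ∈ Finset.range (b + 1) → k ≤ b := fun h =>
    Nat.lt_succ_iff.1 (Finset.mem_range.1 h)
  have hbb : 2 * b ≤ b ^ 2 := by nlinarith
  have hx20 : (X 2 - X 0 : MvPolynomial (Fin 3) 𝕜).IsHomogeneous 1 :=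
    (isHomogeneous_X _ _).sub (isHomogeneous_X _ _)
  -- Lines and curves give multiplicity `b² + (b + 1)(b - 1) = 2b² - 1` at the apex, `b + (b + 1)`
  -- on the middle row and `b` on the long row. The two row exponents supply exactly what is
  -- missing.
  refine ⟨X 2 ^ (2 * b ^ 2 - 1 - b) * ((X 2 - X 0) ^ (2 * b ^ 2 - 1 - (2 * b + 1)) *
    ((∏ j ∈ Finset.range b, slopeForm (j : 𝕜)) ^ b * ∏ k ∈ Finset.range (b + 1), D k)),
    ?_, ?_, fun P hP => ?_⟩
  · have h := ((isHomogeneous_X 𝕜 (2 : Fin 3)).pow (2 * b ^ 2 - 1 - b)).mul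
      ((hx20.pow (2 * b ^ 2 - 1 - (2 * b + 1))).mul
      (((prod_slopeForm_isHomogeneous (Finset.range b) (fun j : ℕ => (j : 𝕜))).pow b).mul
      (IsHomogeneous.prod (Finset.range (b + 1)) D (fun _ => b) fun k hk => hDhom k (hle hk))))
    convert h using 1
    simp only [Finset.card_range, Finset.sum_const, smul_eq_mul, add_mul, one_mul, ← pow_two]
    omega
  · refine mul_ne_zero (pow_ne_zero _ (X_ne_zero _)) (mul_ne_zero (pow_ne_zero _ ?_)
      (mul_ne_zero (pow_ne_zero _ ?_) ?_))
    · intro h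
      have := congrArg (eval ![1, 0, 0]) h
      simp at this
    · rw [Finset.prod_ne_zero_iff]
      intro j _ h
      have := congrArg (eval ![1, 1, 2]) h
      simp at this
    · rw [Finset.prod_ne_zero_iff]
      exact fun k hk => hD0 k (hle hk)
  · rcases mem_standardConfiguration_iff.1 hP with rfl | ⟨j, hj, rfl⟩ | ⟨m, hm, rfl⟩
    · refine Ideal.mul_mem_left _ _ (Ideal.mul_mem_left _ _ ?_)
      have h1 := Ideal.pow_mem_pow (prod_mem_pow (Finset.range b)
        fun j _ => slopeForm_mem_apex (j : 𝕜)) b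
      have h2 := prod_mem_pow (Finset.range (b + 1)) fun k hk => hDapex k (hle hk)
      rw [← pow_mul] at h1 h2
      refine Ideal.pow_le_pow_right ?_ (mul_mem_pow_add h1 h2)
      obtain ⟨c, rfl⟩ : ∃ c, b = c + 1 := ⟨b - 1, by omega⟩
      simp only [Finset.card_range, Nat.add_sub_cancel]
      rw [Nat.sub_le_iff_le_add]
      nlinarith
    · refine Ideal.mul_mem_left _ _ ?_
      have h0 : (X 2 - X 0 : MvPolynomial (Fin 3) 𝕜) ∈ pointIdeal (affinePointP2 (j : 𝕜) 1).rep :=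
        (mem_pointIdeal_affinePointP2_rep hx20 _ _).2 (by simp)
      have h1 : ∏ i ∈ Finset.range b, slopeForm (i : 𝕜) ∈
          pointIdeal (affinePointP2 (j : 𝕜) 1).rep :=
        Ideal.mem_of_dvd _ (Finset.dvd_prod_of_mem _ (Finset.mem_range.2 hj))
          ((mem_pointIdeal_affinePointP2_rep (slopeForm_isHomogeneous _) _ _).2 (by simp; ring))
      have h2 := prod_mem_pow (Finset.range (b + 1)) fun k hk => hDmid k (hle hk) j hj
      refine Ideal.pow_le_pow_right ?_ (mul_mem_pow_add (Ideal.pow_mem_pow h0 _)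
        (mul_mem_pow_add (Ideal.pow_mem_pow h1 b) h2))
      rw [Finset.card_range]
      omega
    · have h0 : (X 2 : MvPolynomial (Fin 3) 𝕜) ∈ pointIdeal (affinePointP2 (m : 𝕜) 0).rep :=
        (mem_pointIdeal_affinePointP2_rep (isHomogeneous_X _ _) _ _).2 (by simp)
      suffices h : (∏ j ∈ Finset.range b, slopeForm (j : 𝕜)) ^ b * ∏ k ∈ Finset.range (b + 1), D k ∈
          pointIdeal (affinePointP2 (m : 𝕜) 0).rep ^ b by
        refine Ideal.pow_le_pow_right ?_ (mul_mem_pow_add (Ideal.pow_mem_pow h0 _)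
          (Ideal.mul_mem_left _ _ h))
        omega
      by_cases hmj : ∃ j < b, m = 2 * j
      · obtain ⟨j, hj, rfl⟩ := hmj
        refine Ideal.mul_mem_right _ _ (Ideal.pow_mem_pow ?_ b)
        exact Ideal.mem_of_dvd _ (Finset.dvd_prod_of_mem _ (Finset.mem_range.2 hj))
          ((mem_pointIdeal_affinePointP2_rep (slopeForm_isHomogeneous _) _ _).2 (by simp; ring))
      · obtain ⟨i, hi, rfl⟩ : ∃ i ≤ b, m = oddIndex b i := by
          -- This index serves both odd `m` and `m = 2b`, where the minimum in `oddIndex` takes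
          -- effect.
          refine ⟨m / 2, by omega, ?_⟩
          unfold oddIndex
          by_contra hne
          exact hmj ⟨m / 2, by omega, by omega⟩
        refine Ideal.mul_mem_left _ _ ?_
        have hi' : i ∈ Finset.range (b + 1) := Finset.mem_range.2 (Nat.lt_succ_of_le hi)
        rw [← Finset.mul_prod_erase _ _ hi']
        refine Ideal.mul_mem_left _ _ ?_
        have := prod_mem_pow ((Finset.range (b + 1)).erase i) fun k hk =>
          hDodd k (hle (Finset.mem_of_mem_erase hk)) i hi (Finset.ne_of_mem_erase hk).symm
        rwa [Finset.card_erase_of_mem hi', Finset.card_range, Nat.add_sub_cancel] at this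

end UpperBound

/-! ### The limit, by squeezing -/

theorem mainTheorem9 (𝕜 : Type*) [Field 𝕜] [IsAlgClosed 𝕜] [CharZero 𝕜] (b : ℕ) (hb : 2 ≤ b) :
    IsWaldschmidtConstant (vanishingIdealP2 (standardConfiguration 𝕜 ![1, b, 2 * b + 1]))
      ((6 * (b : ℝ) ^ 2 - 2 * (b : ℝ) - 3) / (2 * (b : ℝ) ^ 2 - 1)) := by
  obtain ⟨F, hF, hF0, hFmem⟩ := exists_form_mem_pointIdeal_pow (𝕜 := 𝕜) hb
  have hX := finite_standardConfiguration (𝕜 := 𝕜) ![1, b, 2 * b + 1]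
  set I := vanishingIdealP2 (standardConfiguration 𝕜 ![1, b, 2 * b + 1]) with hI
  have hbb : 2 * b ≤ b ^ 2 := by nlinarith
  have hN : 0 < 2 * b ^ 2 - 1 := by omega
  have hmem : ∀ t : ℕ, (6 * b ^ 2 - 2 * b - 3) * (t / (2 * b ^ 2 - 1) + 1) ∈
      {n : ℕ | ∃ f ∈ symbolicPower I t, f ≠ 0 ∧ f.IsHomogeneous n} := by
    intro t
    -- The division is that of natural numbers; adding `1` brings the multiplicity up to at least
    -- `t` at a bounded cost in degree, which vanishes after division by `t`.
    refine ⟨F ^ (t / (2 * b ^ 2 - 1) + 1), mem_symbolicPower_of_forall hX fun P hP => ?_,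
      pow_ne_zero _ hF0, hF.pow _⟩
    have h := Ideal.pow_mem_pow (hFmem P hP) (t / (2 * b ^ 2 - 1) + 1)
    rw [← pow_mul] at h
    exact Ideal.pow_le_pow_right (Nat.lt_mul_div_succ t hN).le h
  have hNR : (0 : ℝ) < 2 * (b : ℝ) ^ 2 - 1 := by
    have : (2 : ℝ) ≤ b := by exact_mod_cast hb
    nlinarith
  have hNcast : ((2 * b ^ 2 - 1 : ℕ) : ℝ) = 2 * (b : ℝ) ^ 2 - 1 := by
    rw [Nat.cast_sub (by omega)]; push_cast; ring
  have hdcast : ((6 * b ^ 2 - 2 * b - 3 : ℕ) : ℝ) = 6 * (b : ℝ) ^ 2 - 2 * b - 3 := by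
    rw [Nat.cast_sub (by omega), Nat.cast_sub (by omega)]; push_cast; ring
  set d : ℝ := 6 * (b : ℝ) ^ 2 - 2 * b - 3 with hd
  have hd0 : 0 ≤ d := hdcast ▸ Nat.cast_nonneg _
  have hlower : ∀ t : ℕ, d * t ≤ (2 * (b : ℝ) ^ 2 - 1) * initialDegree (symbolicPower I t) := by
    intro t
    -- The set of degrees is nonempty, so the infimum is attained and is not the default value `0`.
    obtain ⟨f, hf, hf0, hfn⟩ := Nat.sInf_mem ⟨_, hmem t⟩
    have := mul_le_mul_degree_of_mem_symbolicPower hb hfn hf0 hf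
    have h : (((6 * b ^ 2 - 2 * b - 3 : ℤ) * t : ℤ) : ℝ) ≤
      (((2 * b ^ 2 - 1) * (initialDegree (symbolicPower I t) : ℕ) : ℤ) : ℝ) := by
      exact_mod_cast this
    push_cast at h
    exact h
  have hupper : ∀ t : ℕ, (initialDegree (symbolicPower I t) : ℝ) ≤
      d * (t / (2 * (b : ℝ) ^ 2 - 1) + 1) := by
    intro t
    have h : (initialDegree (symbolicPower I t) : ℝ) ≤
        ((6 * b ^ 2 - 2 * b - 3) * (t / (2 * b ^ 2 - 1) + 1) : ℕ) := by
      exact_mod_cast Nat.sInf_le (hmem t)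
    rw [Nat.cast_mul, hdcast, Nat.cast_add, Nat.cast_one] at h
    refine h.trans (mul_le_mul_of_nonneg_left ?_ hd0)
    have := Nat.cast_div_le (α := ℝ) (m := t) (n := 2 * b ^ 2 - 1)
    rw [hNcast] at this
    linarith
  have hlim : Tendsto (fun t : ℕ => d / (2 * (b : ℝ) ^ 2 - 1) + d / (t : ℝ)) atTop
      (𝓝 (d / (2 * (b : ℝ) ^ 2 - 1))) := by
    simpa using (tendsto_const_nhds (x := d / (2 * (b : ℝ) ^ 2 - 1))).add
      (tendsto_const_div_atTop_nhds_zero_nat d)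
  refine tendsto_of_tendsto_of_tendsto_of_le_of_le' tendsto_const_nhds hlim ?_ ?_
  · filter_upwards [eventually_gt_atTop 0] with t ht
    have ht : (0 : ℝ) < t := by exact_mod_cast ht
    rw [div_le_div_iff₀ hNR ht]
    linarith [hlower t]
  · filter_upwards [eventually_gt_atTop 0] with t ht
    have ht : (0 : ℝ) < t := by exact_mod_cast ht
    rw [div_le_iff₀ ht]
    refine (hupper t).trans (le_of_eq ?_)
    field_simp
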